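/- **Setting.** Let $F$ be a set of activation functions $\mathbb R\to\mathbb R$, whose elements are named by pairwise distinct binary words (so that networks over $F$ can be written as finite strings). An $F$-network $N$ with $n$ input and $m$ output nodes consists of finitely many (at least one) layers of computation nodes; a node computes $\sigma\big(\sum_j c_j y_j+b\big)$ from the outputs $y_j$ of the previous layer (the first layer uses the inputs), with $\sigma\in F$ and rational weights $c_j$ and bias $b$; the last layer is the output layer. $N$ computes a function $\mathbb R^n\to\mathbb R^m$. Let $d$ be a family of metrics, one on each $\mathbb R^n$. For $\varepsilon\in\mathbb Q_{\ge0}\cup\{\infty\}$, $\bar x\in\mathbb Q^n$ and $1\le j\le m$ put $$\mathrm{CR}_d(N,\varepsilon,\bar x,j)\;:\Leftrightarrow\;\forall x\in\mathbb R^n:\ d(x,\bar x)\le\varepsilon\Rightarrow N_j(x)=\max_i N_i(x),$$ $$\mathrm{aCR}_d(N,\varepsilon,\bar x)\;:\Leftrightarrow\;\exists j\in\{1,\dots,m\}:\ \mathrm{CR}_d(N,\varepsilon,\bar x,j).$$ $\mathrm{CR}_d(F)$ and $\mathrm{aCR}_d(F)$ are the problems of deciding these properties for given $(N,\varepsilon,\bar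 x,j)$, respectively $(N,\varepsilon,\bar x)$, where $N$ is an $F$-network; rational numbers are encoded in binary, and polynomial time refers to Turing machines. **Lemma.** i) $\mathrm{aCR}_d(F)$ is polynomial time reducible to $\mathrm{CR}_d(F)$, by a disjunctive truth-table reduction: there is a polynomial time computable function that maps every instance of $\mathrm{aCR}_d(F)$ to a finite list of instances of $\mathrm{CR}_d(F)$ such that the given instance is a yes-instance if and only if at least one instance in the list is a yes-instance. ii) If $d$ is induced by the $p$-norm for some $p\in[1,\infty]$, and if $\mathrm{ReLU}\in F$, where $\mathrm{ReLU}(x)=\max\{0,x\}$, then $\mathrm{CR}_d(F)$ is polynomial time many-one reducible to $\mathrm{aCR}_d(F)$; moreover the reduction can be chosen so that all networks it produces have exactly $3$ output nodes. -/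

import Mathlib

/-! ### Feedforward neural networks with rational weights and biases -/

namespace NeuralNet

/-- The activation function `x ↦ max {0, x}`. -/
noncomputable def ReLU : ℝ → ℝ := fun x => max 0 x

/-- A computation node with `n` incoming connections: an activation function from `F`, a rational
weight for every incoming connection, and a rational bias. -/
structure Neuron (F : Set (ℝ → ℝ)) (n : ℕ) : Type where
  act : F
  weight : Fin n → ℚ
  bias : ℚ

/-- The output `σ (∑ j, c j * y j + b)` of a node. -/
noncomputable def Neuron.eval {F : Set (ℝ → ℝ)} {n : ℕ} (v : Neuron F n) (y : Fin n → ℝ) : ℝ :=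
  (v.act : ℝ → ℝ) ((∑ j, (v.weight j : ℝ) * y j) + (v.bias : ℝ))

/-- A layer of `k` computation nodes on top of a layer with `n` nodes. -/
abbrev Layer (F : Set (ℝ → ℝ)) (n k : ℕ) : Type := Fin k → Neuron F n

/-- A feedforward network with `n` input nodes and `m` output nodes: an output layer, preceded by
any number of hidden layers. Output nodes compute in the same way as hidden nodes. -/
inductive Network (F : Set (ℝ → ℝ)) : ℕ → ℕ → Type
  | output {n m : ℕ} (l : Layer F n m) : Network F n m
  | hidden {n k m : ℕ} (l : Layer F n k) (N : Network F k m) : Network F n m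

/-- The function `ℝⁿ → ℝᵐ` computed by a network. -/
noncomputable def Network.eval {F : Set (ℝ → ℝ)} :
    {n m : ℕ} → Network F n m → (Fin n → ℝ) → (Fin m → ℝ)
  | _, _, .output l, x => fun i => (l i).eval x
  | _, _, .hidden l N, x => N.eval (fun i => (l i).eval x)

/-! ### Classification robustness -/

/-- `CR_d(N, ε, x̄, j)`: on the whole closed `ε`-ball around `x̄` (on all of `ℝⁿ` if `ε = ∞`), the
index `j` is one of the maximizers of `i ↦ N_i(x)`. -/
def ClassRobust {F : Set (ℝ → ℝ)} (d : ∀ n : ℕ, MetricSpace (Fin n → ℝ)) {n m : ℕ}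
    (N : Network F n m) (ε : WithTop ℚ≥0) (xbar : Fin n → ℝ) (j : Fin m) : Prop :=
  ∀ x : Fin n → ℝ, (∀ e : ℚ≥0, ε = (e : WithTop ℚ≥0) → (d n).dist x xbar ≤ (e : ℝ)) →
    ∀ i : Fin m, N.eval x i ≤ N.eval x j

/-- `aCR_d(N, ε, x̄)`. -/
def ArbClassRobust {F : Set (ℝ → ℝ)} (d : ∀ n : ℕ, MetricSpace (Fin n → ℝ)) {n m : ℕ}
    (N : Network F n m) (ε : WithTop ℚ≥0) (xbar : Fin n → ℝ) : Prop :=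
  ∃ j : Fin m, ClassRobust d N ε xbar j

/-- The family `d` of metrics on the spaces `ℝⁿ` is induced by the `p`-norm, for some
`p ∈ [1, ∞]`. -/
def IsPNormMetric (d : ∀ n : ℕ, MetricSpace (Fin n → ℝ)) : Prop :=
  ∃ p : ENNReal, 1 ≤ p ∧
    ∀ (n : ℕ) (x y : Fin n → ℝ), (d n).dist x y = ‖WithLp.toLp p (x - y)‖

/-- The rational data `(N, ε, x̄)`. -/
structure ArbInstance (F : Set (ℝ → ℝ)) : Type where
  inDim : ℕ
  outDim : ℕ
  net : Network F inDim outDim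
  eps : WithTop ℚ≥0
  center : Fin inDim → ℚ

/-- The rational data `(N, ε, x̄, j)`. -/
structure ClassInstance (F : Set (ℝ → ℝ)) : Type extends ArbInstance F where
  index : Fin outDim

/-! ### Encoding of instances by strings over a finite alphabet -/

/-- The alphabet: the two bits, and separators. -/
inductive Letter : Type
  | zero | one | slash | semi | next | done | infty
  deriving DecidableEq

instance : Fintype Letter :=
  ⟨{.zero, .one, .slash, .semi, .next, .done, .infty}, by intro x; cases x <;> simp⟩

/-- A word over `{0, 1}`. -/
def encodeWord (w : List Bool) : List Letter := w.map fun b => cond b Letter.one Letter.zero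

/-- Sign, numerator in binary, denominator in binary (fraction in lowest terms). -/
def encodeRat (q : ℚ) : List Letter :=
  (if q < 0 then Letter.one else Letter.zero) ::
    (encodeWord q.num.natAbs.bits ++ Letter.slash :: (encodeWord q.den.bits ++ [Letter.semi]))

/-- A list of objects with a given encoding. -/
def encodeList {α : Type} (enc : α → List Letter) (l : List α) : List Letter :=
  (l.flatMap fun a => Letter.next :: enc a) ++ [Letter.done]

/-- A tuple of objects with a given encoding. -/
def encodeTuple {α : Type} (enc : α → List Letter) {n : ℕ} (v : Fin n → α) : List Letter :=
  encodeList enc (List.ofFn v)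

/-- A node; `name` is the fixed naming of the activation functions by binary words. -/
def encodeNeuron {F : Set (ℝ → ℝ)} (name : F ↪ List Bool) {n : ℕ} (v : Neuron F n) :
    List Letter :=
  encodeWord (name v.act) ++ Letter.semi :: (encodeRat v.bias ++ encodeTuple encodeRat v.weight)

/-- A network, layer by layer from the input to the output. -/
def encodeNetwork {F : Set (ℝ → ℝ)} (name : F ↪ List Bool) :
    {n m : ℕ} → Network F n m → List Letter
  | _, _, .output l => encodeTuple (encodeNeuron name) l ++ [Letter.done]
  | _, _, .hidden l N => encodeTuple (encodeNeuron name) l ++ Letter.next :: encodeNetwork name N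

/-- A radius in `ℚ≥0 ∪ {∞}`. -/
def encodeRadius : WithTop ℚ≥0 → List Letter
  | ⊤ => [Letter.infty]
  | (e : ℚ≥0) => encodeRat (e : ℚ)

def ArbInstance.encode {F : Set (ℝ → ℝ)} (name : F ↪ List Bool) (I : ArbInstance F) :
    List Letter :=
  encodeTuple encodeRat I.center ++ (encodeRadius I.eps ++ encodeNetwork name I.net)

/-- The index is encoded in unary; as it is smaller than the number of output nodes, it is never
longer than the rest of the encoding. -/
def ClassInstance.encode {F : Set (ℝ → ℝ)} (name : F ↪ List Bool) (I : ClassInstance F) :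
    List Letter :=
  List.replicate (I.index : ℕ) Letter.one ++ Letter.semi :: I.toArbInstance.encode name

/-! ### The encodings are injective -/

section Injectivity

/-- Injective and prefix-free. -/
def PrefixInj {α Γ : Type} (enc : α → List Γ) : Prop :=
  ∀ a b s t, enc a ++ s = enc b ++ t → a = b ∧ s = t

theorem encodeWord_inj {w w' : List Bool} {x y : Letter} {s t : List Letter}
    (hx : x ≠ .zero ∧ x ≠ .one) (hy : y ≠ .zero ∧ y ≠ .one)
    (h : encodeWord w ++ x :: s = encodeWord w' ++ y :: t) : w = w' ∧ x = y ∧ s = t := by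
  induction w generalizing w' with
  | nil =>
    cases w' with
    | nil => simpa [encodeWord] using h
    | cons b w' => cases b <;> simp_all [encodeWord]
  | cons a w ih =>
    cases w' with
    | nil => cases a <;> simp [encodeWord] at h <;> simp_all
    | cons b w' =>
      have h' : cond a Letter.one Letter.zero = cond b Letter.one Letter.zero ∧
          encodeWord w ++ x :: s = encodeWord w' ++ y :: t := by
        simpa [encodeWord] using h
      have hab : a = b := by
        have := h'.1
        cases a <;> cases b <;> simp_all
      have := ih h'.2
      exact ⟨by rw [hab, this.1], this.2⟩

theorem bits_inj {a b : ℕ} (h : a.bits = b.bits) : a = b := by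
  have : Nat.digits 2 a = Nat.digits 2 b := by
    rw [Nat.digits_two_eq_bits, Nat.digits_two_eq_bits, h]
  exact Nat.digits.injective 2 this

theorem encodeRat_inj : PrefixInj encodeRat := by
  intro a b s t h
  simp only [encodeRat, List.cons_append, List.append_assoc, List.nil_append,
    List.cons.injEq] at h
  obtain ⟨hs, h⟩ := h
  obtain ⟨h1, -, h⟩ := encodeWord_inj (by simp) (by simp) h
  obtain ⟨h2, -, h⟩ := encodeWord_inj (by simp) (by simp) h
  have h1 := bits_inj h1
  have h2 := bits_inj h2
  refine ⟨Rat.ext ?_ h2, h⟩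
  have hab : a < 0 ↔ b < 0 := by
    by_cases ha : a < 0 <;> by_cases hb : b < 0 <;> simp [ha, hb] at hs ⊢
  rw [← Rat.num_neg, ← Rat.num_neg] at hab
  omega

theorem encodeList_inj {α : Type} {enc : α → List Letter} (he : PrefixInj enc) :
    PrefixInj (encodeList enc) := by
  intro a b s t h
  induction a generalizing b with
  | nil =>
    cases b with
    | nil => simpa [encodeList] using h
    | cons b bs => simp [encodeList] at h
  | cons a as ih =>
    cases b with
    | nil => simp [encodeList] at h
    | cons b bs =>
      have h' : enc a ++ (encodeList enc as ++ s) = enc b ++ (encodeList enc bs ++ t) := by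
        simpa [encodeList] using h
      obtain ⟨h1, h2⟩ := he _ _ _ _ h'
      obtain ⟨h3, h4⟩ := ih _ h2
      exact ⟨by rw [h1, h3], h4⟩

theorem encodeTuple_inj {α : Type} {enc : α → List Letter} (he : PrefixInj enc) {n n' : ℕ}
    {v : Fin n → α} {v' : Fin n' → α} {s t : List Letter}
    (h : encodeTuple enc v ++ s = encodeTuple enc v' ++ t) :
    (⟨n, v⟩ : Σ n, Fin n → α) = ⟨n', v'⟩ ∧ s = t := by
  obtain ⟨h1, h2⟩ := encodeList_inj he _ _ _ _ h
  exact ⟨List.ofFn_inj'.1 h1, h2⟩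

theorem encodeNeuron_inj {F : Set (ℝ → ℝ)} (name : F ↪ List Bool) {n : ℕ} :
    PrefixInj (encodeNeuron name (n := n)) := by
  rintro ⟨a, w, b⟩ ⟨a', w', b'⟩ s t h
  simp only [encodeNeuron, List.append_assoc, List.cons_append] at h
  obtain ⟨h1, -, h⟩ := encodeWord_inj (by simp) (by simp) h
  obtain ⟨h2, h3⟩ := encodeRat_inj _ _ _ _ h
  obtain ⟨h4, h5⟩ := encodeTuple_inj encodeRat_inj h3
  cases h2
  cases h4
  cases name.injective h1
  exact ⟨rfl, h5⟩

theorem encodeNetwork_inj {F : Set (ℝ → ℝ)} (name : F ↪ List Bool) {n m m' : ℕ}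
    (N : Network F n m) (N' : Network F n m') (s t : List Letter)
    (h : encodeNetwork name N ++ s = encodeNetwork name N' ++ t) :
    (⟨m, N⟩ : Σ m, Network F n m) = ⟨m', N'⟩ ∧ s = t := by
  induction N generalizing m' with
  | output l =>
    cases N' with
    | output l' =>
      simp only [encodeNetwork, List.append_assoc] at h
      obtain ⟨h1, h⟩ := encodeTuple_inj (encodeNeuron_inj name) h
      cases h1
      exact ⟨rfl, by simpa using h⟩
    | hidden l' N' =>
      simp only [encodeNetwork, List.append_assoc] at h
      obtain ⟨h1, h⟩ := encodeTuple_inj (encodeNeuron_inj name) h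
      simp at h
  | hidden l N ih =>
    cases N' with
    | output l' =>
      simp only [encodeNetwork, List.append_assoc] at h
      obtain ⟨h1, h⟩ := encodeTuple_inj (encodeNeuron_inj name) h
      simp at h
    | hidden l' N' =>
      simp only [encodeNetwork, List.append_assoc] at h
      obtain ⟨h1, h2⟩ := encodeTuple_inj (encodeNeuron_inj name) h
      cases h1
      simp only [List.cons_append, List.cons.injEq, true_and] at h2
      obtain ⟨h3, h4⟩ := ih N' h2
      cases h3
      exact ⟨rfl, h4⟩

theorem encodeRadius_inj : PrefixInj encodeRadius := by
  intro a b s t h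
  cases a using WithTop.recTopCoe with
  | top =>
    cases b using WithTop.recTopCoe with
    | top => simpa [encodeRadius] using h
    | coe b =>
      simp only [encodeRadius, encodeRat] at h
      split_ifs at h <;> simp at h
  | coe a =>
    cases b using WithTop.recTopCoe with
    | top =>
      simp only [encodeRadius, encodeRat] at h
      split_ifs at h <;> simp at h
    | coe b =>
      obtain ⟨h1, h⟩ := encodeRat_inj _ _ _ _ h
      exact ⟨by rw [NNRat.coe_inj.1 h1], h⟩

theorem ArbInstance.encode_injective {F : Set (ℝ → ℝ)} (name : F ↪ List Bool) :
    Function.Injective (ArbInstance.encode name) := by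
  rintro ⟨n, m, N, e, c⟩ ⟨n', m', N', e', c'⟩ h
  obtain ⟨h1, h⟩ := encodeTuple_inj encodeRat_inj h
  cases h1
  obtain ⟨h2, h⟩ := encodeRadius_inj _ _ _ _ h
  cases h2
  obtain ⟨h3, -⟩ := encodeNetwork_inj name N N' [] [] (by simpa using h)
  cases h3
  rfl

theorem ClassInstance.encode_injective {F : Set (ℝ → ℝ)} (name : F ↪ List Bool) :
    Function.Injective (ClassInstance.encode name) := by
  rintro ⟨I, j⟩ ⟨I', j'⟩ h
  have hrep : ∀ k : ℕ, List.replicate k Letter.one = encodeWord (List.replicate k true) := by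
    intro k
    simp [encodeWord]
  simp only [ClassInstance.encode, hrep] at h
  obtain ⟨h1, -, h⟩ := encodeWord_inj (by simp) (by simp) h
  cases ArbInstance.encode_injective name h
  have h2 : (j : ℕ) = j' := by simpa using congrArg List.length h1
  cases Fin.ext h2
  rfl

end Injectivity

/-! ### Decision problems and polynomial time reductions -/

/-- A decision problem: instances, written as strings over a finite alphabet, and the set of
yes-instances. -/
structure DecisionProblem where
  Inst : Type
  Alphabet : Type
  alphabetFintype : Fintype Alphabet
  encode : Inst → List Alphabet
  encode_injective : Function.Injective encode
  Holds : Inst → Prop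

/-- `f` is a polynomial time many-one reduction from `P` to `Q`. -/
def IsManyOneReduction (P Q : DecisionProblem) (f : P.Inst → Q.Inst) : Prop :=
  Nonempty (Turing.TM2ComputableInPolyTime P.encode Q.encode f) ∧
    ∀ I : P.Inst, P.Holds I ↔ Q.Holds (f I)

/-- A list of instances of `Q`, each one followed by the extra letter `none`. -/
def DecisionProblem.encodeQueries (Q : DecisionProblem) (l : List Q.Inst) :
    List (Option Q.Alphabet) :=
  l.flatMap fun J => (Q.encode J).map some ++ [none]

/-- `f` is a polynomial time disjunctive truth-table reduction from `P` to `Q`: from an instance of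
`P`, it computes a list of instances of `Q` at least one of which is a yes-instance if and only if
the given instance is one. -/
def IsDisjunctiveReduction (P Q : DecisionProblem) (f : P.Inst → List Q.Inst) : Prop :=
  Nonempty (Turing.TM2ComputableInPolyTime P.encode Q.encodeQueries f) ∧
    ∀ I : P.Inst, P.Holds I ↔ ∃ J ∈ f I, Q.Holds J

/-- The problem `CR_d(F)`. -/
def CR (F : Set (ℝ → ℝ)) (name : F ↪ List Bool) (d : ∀ n : ℕ, MetricSpace (Fin n → ℝ)) :
    DecisionProblem where
  Inst := ClassInstance F
  Alphabet := Letter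
  alphabetFintype := inferInstance
  encode := ClassInstance.encode name
  encode_injective := ClassInstance.encode_injective name
  Holds I := ClassRobust d I.net I.eps (fun i => (I.center i : ℝ)) I.index

/-- The problem `aCR_d(F)`. -/
def aCR (F : Set (ℝ → ℝ)) (name : F ↪ List Bool) (d : ∀ n : ℕ, MetricSpace (Fin n → ℝ)) :
    DecisionProblem where
  Inst := ArbInstance F
  Alphabet := Letter
  alphabetFintype := inferInstance
  encode := ArbInstance.encode name
  encode_injective := ArbInstance.encode_injective name
  Holds I := ArbClassRobust d I.net I.eps (fun i => (I.center i : ℝ))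

end NeuralNet

/-! Part i): `aCR` is by definition the disjunction of `CR` over the output indices, so the queries
are the given data together with each `j`. All the work lies in producing this list in polynomial
time.

Part ii): the network `N` is extended by two inputs, clamped to `t₁, t₂ ≥ 0` by ReLU and passed
unchanged through all layers. With `e = ∑ i, ReLU (N_i - N_j)`, which vanishes exactly where `j` is
a maximizer, the new outputs are `ReLU (t₁ - t₂ + e)`, `ReLU (t₂ - t₁ + e)` and `t₁ + t₂`. If `e =
0` on the ball, the third output is always maximal, because `|t₁ - t₂| ≤ t₁ + t₂`. Conversely, the
first output loses against the second where `t₁ < t₂`, and the second against the first where `t₂ <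
t₁`. If the third is always maximal, then the points with `t₁ = t₂ = 0` force `e = 0`. This is
`exists_forall_le_iff`. For a p-norm, dropping the two coordinates does not increase distances and
inserting zeros preserves them, so `e` ranges over the original ball; a positive radius leaves room
for both strict comparisons (`arbClassRobust_iff_of_eval`).

Radius zero leaves no such room. The ball is then the single point `x̄`, which is built into the
network: only `t₁, t₂` remain as inputs, the radius becomes `1`, and a new first layer produces the
center. Since a ReLU node yields only nonnegative constants, it produces `|x̄_i|`, and the signs go
into the weights of the first layer of `N` (`flipSigns_signs`, `holds_toArb`).

Polynomial time is shown for actual machines through a small structured language over several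
stacks. `Exec` is its semantics with a step bound, `Exec.reaches` shows that the compiled `TM2`
machine simulates it, and `computableInPolyTime_of_exec` packages the result. Both reductions are
written in this language (`exec_queries`, `exec_reduce`); they take quadratic time, and the name of
ReLU is a constant of the program. -/

namespace StackProgram

/-! ### Structured stack programs and their compilation to Turing machines -/

open Turing

/-- Structured programs over stacks indexed by `K`: a `case` pops a stack and branches on the
popped symbol, a `loop` pops a stack and executes its body until the stack is empty or an exit
symbol has been popped. -/
inductive Prog {K : Type} (Γ : K → Type) : Type
  | skip : Prog Γ
  | push (k : K) (a : Γ k) : Prog Γ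
  | seq (p q : Prog Γ) : Prog Γ
  | case (k : K) (f : Option (Γ k) → Prog Γ) : Prog Γ
  | loop (k : K) (e : Γ k → Bool) (f : Γ k → Prog Γ) : Prog Γ

infixr:65 " ⨾ " => Prog.seq

variable {K : Type} {Γ : K → Type}

/-- `Exec p s t n`: started with the stacks `s`, the program `p` stops with the stacks `t` after at
most `n` steps. -/
inductive Exec [DecidableEq K] : Prog Γ → (∀ k, List (Γ k)) → (∀ k, List (Γ k)) → ℕ → Prop
  | skip (s) : Exec .skip s s 1
  | push (k a s) : Exec (.push k a) s (Function.update s k (a :: s k)) 1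
  | seq {p q s t u m n} : Exec p s t m → Exec q t u n → Exec (.seq p q) s u (m + n)
  | case {k f s t n} : Exec (f (s k).head?) (Function.update s k (s k).tail) t n →
      Exec (.case k f) s t (n + 1)
  | exit {k e f s} (h : ∀ a ∈ (s k).head?, e a = true) :
      Exec (.loop k e f) s (Function.update s k (s k).tail) 1
  | iter {k e f s t u a m n} (ha : (s k).head? = some a) (h : e a = false) :
      Exec (f a) (Function.update s k (s k).tail) t m → Exec (.loop k e f) t u n →
      Exec (.loop k e f) s u (m + n + 1)
  | mono {p s t m n} : Exec p s t m → m ≤ n → Exec p s t n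

/-- A step pushes at most one symbol. This bounds the length of an output by the time spent on it,
so that no separate size estimate for the constructed network is needed. -/
theorem Exec.length_le [DecidableEq K] {p : Prog Γ} {s t : ∀ k, List (Γ k)} {n : ℕ}
    (h : Exec p s t n) (k : K) : (t k).length ≤ (s k).length + n := by
  have hpop : ∀ (s : ∀ k, List (Γ k)) (k' : K),
      (Function.update s k' (s k').tail k).length ≤ (s k).length := by
    intro s k'
    by_cases hk : k = k'
    · subst hk
      simp
    · simp [hk]
  induction h with
  | skip s => omega
  | push k' a s =>
    by_cases hk : k = k'
    · subst hk
      simp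
    · simp [hk]
  | seq hp hq ihp ihq => omega
  | @case k' f s t n hf ih =>
    have := hpop s k'
    omega
  | @exit k' e f s hs =>
    have := hpop s k'
    omega
  | @iter k' e f s t u a m n ha he hf hl ihf ihl =>
    have := hpop s k'
    omega
  | mono h hle ih => omega

/-- The control points of a program. -/
def Prog.Label : Prog Γ → Type
  | .skip => Unit
  | .push _ _ => Unit
  | .seq p q => p.Label ⊕ q.Label
  | .case k f => Unit ⊕ (Σ o : Option (Γ k), (f o).Label)
  | .loop k _ f => Unit ⊕ (Σ a : Γ k, (f a).Label)

theorem Prog.finite_label [∀ k, Finite (Γ k)] (p : Prog Γ) : Finite p.Label := by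
  induction p with
  | skip => exact inferInstanceAs (Finite Unit)
  | push => exact inferInstanceAs (Finite Unit)
  | seq p q hp hq => exact inferInstanceAs (Finite (p.Label ⊕ q.Label))
  | case k f h => exact inferInstanceAs (Finite (Unit ⊕ (Σ o : Option (Γ k), (f o).Label)))
  | loop k e f h => exact inferInstanceAs (Finite (Unit ⊕ (Σ a : Γ k, (f a).Label)))

/-- The initial control point. -/
def Prog.entry : (p : Prog Γ) → p.Label
  | .skip => ()
  | .push _ _ => ()
  | .seq p _ => Sum.inl p.entry
  | .case _ _ => Sum.inl ()
  | .loop _ _ _ => Sum.inl ()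

/-- The `TM2` statements of a program, where `ι` places the control points of the program among
the labels of a machine, and where control is passed to `next` at the end. The internal state of
the machine stores the symbol that was last popped from each stack. -/
def Prog.code [DecidableEq K] {Λ : Type} :
    (p : Prog Γ) → (p.Label → Λ) → Λ → p.Label → TM2.Stmt Γ Λ (∀ k, Option (Γ k))
  | .skip, _, next, _ => .goto fun _ => next
  | .push k a, _, next, _ => .push k (fun _ => a) (.goto fun _ => next)
  | .seq p q, ι, _, .inl l => p.code (fun l => ι (.inl l)) (ι (.inr q.entry)) l
  | .seq _ q, ι, next, .inr l => q.code (fun l => ι (.inr l)) next l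
  | .case k f, ι, _, .inl _ =>
      .pop k (fun v o => Function.update v k o)
        (.goto fun v => ι (.inr ⟨v k, (f (v k)).entry⟩))
  | .case _ f, ι, next, .inr ⟨o, l⟩ => (f o).code (fun l => ι (.inr ⟨o, l⟩)) next l
  | .loop k e f, ι, next, .inl _ =>
      .pop k (fun v o => Function.update v k o)
        (.goto fun v => match v k with
          | none => next
          | some a => if e a then next else ι (.inr ⟨a, (f a).entry⟩))
  | .loop _ _ f, ι, _, .inr ⟨a, l⟩ =>
      (f a).code (fun l => ι (.inr ⟨a, l⟩)) (ι (.inl ())) l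

theorem iterate_bind_trans {α : Type*} {f : α → Option α} {a b c : Option α} {m n : ℕ}
    (h : (flip bind f)^[m] a = b) (h' : (flip bind f)^[n] b = c) :
    (flip bind f)^[m + n] a = c := by
  rw [Nat.add_comm, Function.iterate_add_apply, h, h']

/-- Correctness of the compilation, by induction on the execution. The placement `ι` and the exit
`next` are arbitrary because a subprogram runs inside a larger machine; the stored symbols `v` are
arbitrary because every branch reads only the symbol it has just popped. Only `m ≤ n` can be
claimed, as `Exec` allows overestimated times. -/
theorem Exec.reaches [DecidableEq K] {p : Prog Γ} {s t : ∀ k, List (Γ k)} {n : ℕ}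
    (h : Exec p s t n) {Λ : Type} (M : Λ → TM2.Stmt Γ Λ (∀ k, Option (Γ k)))
    (ι : p.Label → Λ) (next : Λ) (hM : ∀ l, M (ι l) = p.code ι next l)
    (v : ∀ k, Option (Γ k)) :
    ∃ v' m, m ≤ n ∧ (flip bind (TM2.step M))^[m] (some ⟨some (ι p.entry), v, s⟩) =
      some ⟨some next, v', t⟩ := by
  induction h generalizing Λ v with
  | skip s =>
    exact ⟨v, 1, le_rfl, by simp [flip, TM2.step, hM, Prog.code]⟩
  | push k a s =>
    exact ⟨v, 1, le_rfl, by simp [flip, TM2.step, hM, Prog.code]⟩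
  | seq hp hq ihp ihq =>
    obtain ⟨v', m, hm, h⟩ := ihp M _ _ (fun l => hM (.inl l)) v
    obtain ⟨v'', m', hm', h'⟩ := ihq M _ _ (fun l => hM (.inr l)) v'
    exact ⟨v'', m + m', by omega, iterate_bind_trans h h'⟩
  | @case k f s t n hf ih =>
    obtain ⟨v', m, hm, h⟩ := ih M _ _ (fun l => hM (.inr ⟨_, l⟩))
      (Function.update v k (s k).head?)
    refine ⟨v', 1 + m, by omega, iterate_bind_trans ?_ h⟩
    have h₀ := hM (.inl ())
    simp [flip, TM2.step, h₀, Prog.code, Prog.entry]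
    rw [Function.update_self]
  | @exit k e f s hs =>
    refine ⟨Function.update v k (s k).head?, 1, le_rfl, ?_⟩
    have h₀ := hM (.inl ())
    simp only [flip, TM2.step, h₀, Prog.code, Prog.entry, Function.iterate_one, TM2.stepAux,
      Function.update_self, Option.bind_eq_bind, Option.bind_some]
    cases ho : (s k).head? with
    | none => simp
    | some a => simp [hs a ho]
  | @iter k e f s t u a m n ha he hf hl ihf ihl =>
    obtain ⟨v', m, hm, h⟩ := ihf M _ _ (fun l => hM (.inr ⟨_, l⟩))
      (Function.update v k (s k).head?)
    obtain ⟨v'', m', hm', h'⟩ := ihl M _ _ hM v'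
    refine ⟨v'', 1 + m + m', by omega, iterate_bind_trans (iterate_bind_trans ?_ h) h'⟩
    have h₀ := hM (.inl ())
    simp [flip, TM2.step, h₀, Prog.code, Prog.entry, ha, he]
  | mono h hle ih =>
    obtain ⟨v', m, hm, h⟩ := ih M _ _ hM v
    exact ⟨v', m, hm.trans hle, h⟩

/-- The Turing machine of a program. -/
noncomputable def Prog.machine [DecidableEq K] [Fintype K] [∀ k, Fintype (Γ k)] (p : Prog Γ)
    (k₀ k₁ : K) : FinTM2 :=
  haveI := p.finite_label
  haveI : Fintype (Option p.Label) := Fintype.ofFinite _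
  { K := K
    k₀ := k₀
    k₁ := k₁
    Γ := Γ
    Λ := Option p.Label
    main := some p.entry
    σ := ∀ k, Option (Γ k)
    initialState := fun _ => none
    m := fun l => match l with
      -- The required halting configuration carries the initial internal state, so the stored
      -- symbols are erased before halting.
      | none => .load (fun _ _ => none) .halt
      | some l => p.code some none l }

/-- A program that transforms the encoding of every `x`, on the stack `k₀`, into the encoding of
`f x`, on the stack `k₁`, in polynomial time, yields a polynomial time Turing machine for `f`. -/
theorem computableInPolyTime_of_exec [DecidableEq K] [Fintype K] [∀ k, Fintype (Γ k)]
    {α β : Type} (p : Prog Γ) (k₀ k₁ : K) (ea : α → List (Γ k₀)) (eb : β → List (Γ k₁))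
    (f : α → β) (time : Polynomial ℕ)
    (h : ∀ x, Exec p (Function.update (fun _ => []) k₀ (ea x))
      (Function.update (fun _ => []) k₁ (eb (f x))) (time.eval (ea x).length)) :
    Nonempty (TM2ComputableInPolyTime ea eb f) := by
  -- The initial and final configurations of `FinTM2` place a word on one stack by a cast along `k =
  -- k₀`; this is the same as an update of the empty stacks.
  have hdite : ∀ (k₀ : K) (w : List (Γ k₀)), (fun k => @dite (List (Γ k)) (k = k₀) _
      (fun h => by rw [h]; exact w) fun _ => []) = Function.update (fun _ => []) k₀ w := by
    intro k₀ w
    funext k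
    by_cases hk : k = k₀
    · subst hk
      simp
    · simp [hk]
  refine ⟨{ tm := p.machine k₀ k₁
            inputAlphabet := Equiv.refl _
            outputAlphabet := Equiv.refl _
            time := time + 1
            outputsFun := fun x => Classical.choice ?_ }⟩
  obtain ⟨v, m, hm, hx⟩ := (h x).reaches (p.machine k₀ k₁).m some none (fun _ => rfl)
    (fun _ => none)
  -- The extra step executes the label `none`, which resets the state and halts.
  refine ⟨⟨⟨m + 1, ?_⟩, by simpa using hm⟩⟩
  refine iterate_bind_trans (b := some ⟨some none, v,
    Function.update (fun _ => []) k₁ (eb (f x))⟩) (Eq.trans ?_ hx) ?_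
  · exact congrArg (fun u => (flip bind _)^[m] (some (TM2.Cfg.mk _ _ u)))
      ((hdite k₀ _).trans (congrArg _ (List.map_id _)))
  · exact congrArg (fun u => some (TM2.Cfg.mk _ _ u))
      ((hdite k₁ _).trans (congrArg _ (List.map_id _))).symm

end StackProgram

/-! ### Basic stack operations and their running times -/

namespace StackProgram

variable {K : Type} {Γ : K → Type}

theorem Exec.congr [DecidableEq K] {p : Prog Γ} {s t t' : ∀ k, List (Γ k)} {m n : ℕ}
    (h : Exec p s t m) (ht : t = t') (hmn : m ≤ n) : Exec p s t' n :=
  ht ▸ h.mono hmn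

theorem Exec.congr' [DecidableEq K] {p : Prog Γ} {s s' t : ∀ k, List (Γ k)} {n : ℕ}
    (h : Exec p s t n) (hs : s = s') : Exec p s' t n :=
  hs ▸ h

/-- Push a word onto a stack. -/
def emit (k : K) (w : List (Γ k)) : Prog Γ := w.foldr (fun a p => .push k a ⨾ p) .skip

/-- Move the symbols of the stack `k`, up to an exit symbol, to the stack `l`. -/
def move (k l : K) (e : Γ k → Bool) (φ : Γ k → Γ l) : Prog Γ := .loop k e fun a => .push l (φ a)

/-- Move the stack `k` to the stack `l'` and push the word `ψ a` onto the stack `l` for every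
moved symbol `a`. -/
def spread (k l l' : K) (ψ : Γ k → List (Γ l)) (φ : Γ k → Γ l') : Prog Γ :=
  .loop k (fun _ => false) fun a => emit l (ψ a) ⨾ .push l' (φ a)

/-- Empty a stack. -/
def clear (Γ : K → Type) (k : K) : Prog Γ := .loop k (fun _ => false) fun _ => .skip

variable [DecidableEq K]

theorem exec_emit (k : K) (w : List (Γ k)) (s : ∀ k, List (Γ k)) :
    Exec (emit k w) s (Function.update s k (w.reverse ++ s k)) (w.length + 1) := by
  induction w generalizing s with
  | nil => exact (Exec.skip s).congr (by simp) (by simp)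
  | cons a w ih => exact ((Exec.push k a s).seq (ih _)).congr (by simp) (by simp; omega)

theorem exec_move {k l : K} (hkl : k ≠ l) {e : Γ k → Bool} {φ : Γ k → Γ l}
    (w r : List (Γ k)) (s : ∀ k, List (Γ k)) (hs : s k = w ++ r) (hw : ∀ a ∈ w, e a = false)
    (hr : ∀ a ∈ r.head?, e a = true) :
    Exec (move k l e φ) s
      (Function.update (Function.update s k r.tail) l ((w.map φ).reverse ++ s l))
      (2 * w.length + 1) := by
  induction w generalizing s with
  | nil =>
    refine (Exec.exit (by simpa [hs] using hr)).congr ?_ (by simp)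
    rw [hs]
    ext1 x
    by_cases hx : x = l
    · subst hx
      simp [hkl.symm]
    · simp [hx]
  | cons a w ih =>
    have ih := ih (Function.update (Function.update s k (w ++ r)) l (φ a :: s l))
      (by simp [hkl]) (fun b hb => hw b (by simp [hb]))
    refine (Exec.iter (a := a) (by simp [hs]) (hw a (by simp))
      (t := Function.update (Function.update s k (w ++ r)) l (φ a :: s l)) (m := 1) ?_ ih).congr
      ?_ (by simp; omega)
    · refine (Exec.push l (φ a) _).congr ?_ le_rfl
      simp [hs, hkl.symm]
    · ext1 x
      by_cases hx : x = l
      · subst hx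
        simp
      · by_cases hx' : x = k
        · subst hx'
          simp [hx]
        · simp [hx, hx']

theorem exec_spread {k l l' : K} (hkl : k ≠ l) (hkl' : k ≠ l') (hll' : l ≠ l')
    {ψ : Γ k → List (Γ l)} {φ : Γ k → Γ l'} {L : ℕ} (hL : ∀ a, (ψ a).length ≤ L)
    (s : ∀ k, List (Γ k)) :
    Exec (spread k l l' ψ φ) s
      (Function.update (Function.update (Function.update s k []) l
        (((s k).flatMap ψ).reverse ++ s l)) l' (((s k).map φ).reverse ++ s l'))
      ((L + 3) * (s k).length + 1) := by
  generalize hw : s k = w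
  induction w generalizing s with
  | nil =>
    refine (Exec.exit (by simp [hw])).congr ?_ (by simp)
    ext1 x
    by_cases hx : x = l'
    · subst hx
      simp [hkl'.symm]
    · by_cases hx' : x = l
      · subst hx'
        simp [hx, hkl.symm]
      · simp [hx, hx', hw]
  | cons a w ih =>
    have ih := ih (Function.update (Function.update (Function.update s k w) l
      ((ψ a).reverse ++ s l)) l' (φ a :: s l')) (by simp [hkl, hkl'])
    refine (Exec.iter (a := a) (by simp [hw]) rfl
      (t := Function.update (Function.update (Function.update s k w) l
      ((ψ a).reverse ++ s l)) l' (φ a :: s l')) (m := (ψ a).length + 2) ?_ ih).congr ?_ ?_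
    · refine ((exec_emit l (ψ a) _).seq (Exec.push l' (φ a) _)).congr ?_ le_rfl
      simp [hw, hkl.symm, hkl'.symm, hll'.symm]
    · ext1 x
      by_cases hx : x = l'
      · subst hx
        simp
      · by_cases hx' : x = l
        · subst hx'
          simp [hx]
        · by_cases hx'' : x = k
          · subst hx''
            simp [hx, hx']
          · simp [hx, hx', hx'']
    · have := hL a
      simp only [List.length_cons, Nat.mul_add, Nat.mul_one]
      omega

theorem exec_clear (k : K) (s : ∀ k, List (Γ k)) :
    Exec (clear Γ k) s (Function.update s k []) (2 * (s k).length + 1) := by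
  generalize hw : s k = w
  induction w generalizing s with
  | nil => exact (Exec.exit (by simp [hw])).congr (by simp [hw]) (by simp)
  | cons a w ih =>
    refine (Exec.iter (a := a) (by simp [hw]) rfl (Exec.skip _) (ih _ (by simp [hw]))).congr
      (by simp) (by simp; omega)

/-- A loop over the entries of a list, where `x` is coded by the symbol `b` followed by `enc x`, and
where the exit symbol `z` follows the list; `S d r` are the stacks after the list `d` has been
processed, with `r` left on the stack `k`. -/
theorem exec_loop_flatMap {α : Type*} {k : K} {e : Γ k → Bool} {body : Γ k → Prog Γ}
    (b z : Γ k) (hb : e b = false) (hz : e z = true) (enc : α → List (Γ k))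
    (S : List α → List (Γ k) → ∀ k, List (Γ k)) (hS : ∀ d r, S d r k = r)
    (hS' : ∀ d r r', Function.update (S d r) k r' = S d r') (T : ℕ)
    (hbody : ∀ d x r, Exec (body b) (S d (enc x ++ r)) (S (d ++ [x]) r)
      (T * ((enc x).length + 1)))
    (xs d : List α) (r : List (Γ k)) :
    Exec (.loop k e body) (S d ((xs.flatMap fun x => b :: enc x) ++ z :: r)) (S (d ++ xs) r)
      ((T + 1) * ((xs.flatMap fun x => b :: enc x).length + 1)) := by
  induction xs generalizing d with
  | nil => exact (Exec.exit (by simp [hS, hz])).congr (by simp [hS, hS']) (by simp)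
  | cons x xs ih =>
    refine (Exec.iter (a := b) (by simp [hS]) hb (t := S (d ++ [x]) _)
      ?_ (ih (d ++ [x]))).congr (by simp) ?_ (m := T * ((enc x).length + 1) + _ + 1)
    · rw [hS']
      simpa [hS] using hbody d x ((xs.flatMap fun x => b :: enc x) ++ z :: r)
    · simp only [List.flatMap_cons, List.length_append, List.length_cons]
      nlinarith

end StackProgram

/-! ### The stacks of the two reductions, and the copying of semicolon-terminated items -/

namespace NeuralNet

open StackProgram

/-- The stacks of the reductions. -/
inductive Stk : Type
  | inp | out | a | b | c | g | j | q
  deriving DecidableEq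

instance : Fintype Stk :=
  ⟨{.inp, .out, .a, .b, .c, .g, .j, .q}, by intro x; cases x <;> simp⟩

/-- The alphabets of the stacks. -/
abbrev Sym : Stk → Type
  | .inp => Letter
  | .out => Letter
  | .a => Letter
  | .b => Letter
  | .c => Letter
  | .g => Letter
  | .j => Letter
  | .q => Option Letter

instance : ∀ k, Fintype (Sym k)
  | .inp => inferInstanceAs (Fintype Letter)
  | .out => inferInstanceAs (Fintype Letter)
  | .a => inferInstanceAs (Fintype Letter)
  | .b => inferInstanceAs (Fintype Letter)
  | .c => inferInstanceAs (Fintype Letter)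
  | .g => inferInstanceAs (Fintype Letter)
  | .j => inferInstanceAs (Fintype Letter)
  | .q => inferInstanceAs (Fintype (Option Letter))

/-- The contents of all stacks. -/
def st (i o a b c g j : List Letter) (q : List (Option Letter)) : ∀ k, List (Sym k)
  | .inp => i
  | .out => o
  | .a => a
  | .b => b
  | .c => c
  | .g => g
  | .j => j
  | .q => q

section Stacks

variable (i o a b c g j : List Letter) (q : List (Option Letter)) (x : List Letter)

@[simp] theorem st_inp : st i o a b c g j q .inp = i := rfl
@[simp] theorem st_out : st i o a b c g j q .out = o := rfl
@[simp] theorem st_a : st i o a b c g j q .a = a := rfl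
@[simp] theorem st_b : st i o a b c g j q .b = b := rfl
@[simp] theorem st_c : st i o a b c g j q .c = c := rfl
@[simp] theorem st_g : st i o a b c g j q .g = g := rfl
@[simp] theorem st_j : st i o a b c g j q .j = j := rfl
@[simp] theorem st_q : st i o a b c g j q .q = q := rfl

@[simp] theorem update_inp :
    Function.update (st i o a b c g j q) .inp x = st x o a b c g j q := by
  funext k; cases k <;> rfl

@[simp] theorem update_out :
    Function.update (st i o a b c g j q) .out x = st i x a b c g j q := by
  funext k; cases k <;> rfl

@[simp] theorem update_a :
    Function.update (st i o a b c g j q) .a x = st i o x b c g j q := by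
  funext k; cases k <;> rfl

@[simp] theorem update_b :
    Function.update (st i o a b c g j q) .b x = st i o a x c g j q := by
  funext k; cases k <;> rfl

@[simp] theorem update_c :
    Function.update (st i o a b c g j q) .c x = st i o a b x g j q := by
  funext k; cases k <;> rfl

@[simp] theorem update_g :
    Function.update (st i o a b c g j q) .g x = st i o a b c x j q := by
  funext k; cases k <;> rfl

@[simp] theorem update_j :
    Function.update (st i o a b c g j q) .j x = st i o a b c g x q := by
  funext k; cases k <;> rfl

@[simp] theorem update_q (x : List (Option Letter)) :
    Function.update (st i o a b c g j q) .q x = st i o a b c g j x := by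
  funext k; cases k <;> rfl

theorem st_nil_inp :
    st i [] [] [] [] [] [] [] =
      Function.update (β := fun k => List (Sym k)) (fun _ => []) Stk.inp i := by
  funext k; cases k <;> rfl

theorem st_nil_q :
    st [] [] [] [] [] [] [] q =
      Function.update (β := fun k => List (Sym k)) (fun _ => []) Stk.q q := by
  funext k; cases k <;> rfl

end Stacks

section Steps

variable (i o a b c g j : List Letter) (q : List (Option Letter)) (x : Letter)

theorem exec_push_inp :
    Exec (.push .inp x) (st i o a b c g j q) (st (x :: i) o a b c g j q) 1 :=
  (Exec.push _ _ _).congr (by simp) le_rfl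

theorem exec_push_out :
    Exec (.push .out x) (st i o a b c g j q) (st i (x :: o) a b c g j q) 1 :=
  (Exec.push _ _ _).congr (by simp) le_rfl

theorem exec_push_a :
    Exec (.push .a x) (st i o a b c g j q) (st i o (x :: a) b c g j q) 1 :=
  (Exec.push _ _ _).congr (by simp) le_rfl

theorem exec_push_b :
    Exec (.push .b x) (st i o a b c g j q) (st i o a (x :: b) c g j q) 1 :=
  (Exec.push _ _ _).congr (by simp) le_rfl

theorem exec_push_c :
    Exec (.push .c x) (st i o a b c g j q) (st i o a b (x :: c) g j q) 1 :=
  (Exec.push _ _ _).congr (by simp) le_rfl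

theorem exec_move_a_b :
    Exec (move .a .b (fun _ => false) id) (st i o a b c g j q) (st i o [] (a.reverse ++ b) c g j q)
      (2 * a.length + 1) :=
  (exec_move (by decide) a [] _ (by simp) (by simp) (by simp)).congr (by simp) le_rfl

theorem exec_move_b_out :
    Exec (move .b .out (fun _ => false) id) (st i o a b c g j q) (st i (b.reverse ++ o) a [] c g j q)
      (2 * b.length + 1) :=
  (exec_move (by decide) b [] _ (by simp) (by simp) (by simp)).congr (by simp) le_rfl

theorem exec_move_b_c :
    Exec (move .b .c (fun _ => false) id) (st i o a b c g j q) (st i o a [] (b.reverse ++ c) g j q)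
      (2 * b.length + 1) :=
  (exec_move (by decide) b [] _ (by simp) (by simp) (by simp)).congr (by simp) le_rfl

theorem exec_move_b_g :
    Exec (move .b .g (fun _ => false) id) (st i o a b c g j q) (st i o a [] c (b.reverse ++ g) j q)
      (2 * b.length + 1) :=
  (exec_move (by decide) b [] _ (by simp) (by simp) (by simp)).congr (by simp) le_rfl

theorem exec_move_a_g :
    Exec (move .a .g (fun _ => false) id) (st i o a b c g j q) (st i o [] b c (a.reverse ++ g) j q)
      (2 * a.length + 1) :=
  (exec_move (by decide) a [] _ (by simp) (by simp) (by simp)).congr (by simp) le_rfl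

theorem exec_move_a_c :
    Exec (move .a .c (fun _ => false) id) (st i o a b c g j q) (st i o [] b (a.reverse ++ c) g j q)
      (2 * a.length + 1) :=
  (exec_move (by decide) a [] _ (by simp) (by simp) (by simp)).congr (by simp) le_rfl

theorem exec_move_out_inp :
    Exec (move .out .inp (fun _ => false) id) (st i o a b c g j q) (st (o.reverse ++ i) [] a b c g j q)
      (2 * o.length + 1) :=
  (exec_move (by decide) o [] _ (by simp) (by simp) (by simp)).congr (by simp) le_rfl

theorem exec_move_inp_a :
    Exec (move .inp .a (fun _ => false) id) (st i o a b c g j q) (st [] o (i.reverse ++ a) b c g j q)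
      (2 * i.length + 1) :=
  (exec_move (by decide) i [] _ (by simp) (by simp) (by simp)).congr (by simp) le_rfl

theorem exec_clear_c :
    Exec (clear Sym .c) (st i o a b c g j q) (st i o a b [] g j q)
      (2 * c.length + 1) :=
  (exec_clear _ _).congr (by simp) le_rfl

theorem exec_clear_g :
    Exec (clear Sym .g) (st i o a b c g j q) (st i o a b c [] j q)
      (2 * g.length + 1) :=
  (exec_clear _ _).congr (by simp) le_rfl

theorem exec_clear_a :
    Exec (clear Sym .a) (st i o a b c g j q) (st i o [] b c g j q)
      (2 * a.length + 1) :=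
  (exec_clear _ _).congr (by simp) le_rfl

theorem exec_emit_out (w : List Letter) :
    Exec (emit .out w) (st i o a b c g j q) (st i (w.reverse ++ o) a b c g j q) (w.length + 1) :=
  (exec_emit _ _ _).congr (by simp) le_rfl

variable {i o a b c g j q x}

theorem exec_iter_inp {e : Letter → Bool} {f : Letter → Prog Sym} {t u : ∀ k, List (Sym k)}
    {m n : ℕ} (he : e x = false) (h : Exec (f x) (st i o a b c g j q) t m)
    (h' : Exec (.loop .inp e f) t u n) :
    Exec (.loop .inp e f) (st (x :: i) o a b c g j q) u (m + n + 1) :=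
  Exec.iter rfl he (by simpa using h) h'

theorem exec_exit_inp {e : Letter → Bool} {f : Letter → Prog Sym} (he : e x = true) :
    Exec (.loop .inp e f) (st (x :: i) o a b c g j q) (st i o a b c g j q) 1 :=
  (Exec.exit (by simpa using he)).congr (by simp) le_rfl

theorem exec_iter_c {e : Letter → Bool} {f : Letter → Prog Sym} {t u : ∀ k, List (Sym k)}
    {m n : ℕ} (he : e x = false) (h : Exec (f x) (st i o a b c g j q) t m)
    (h' : Exec (.loop .c e f) t u n) :
    Exec (.loop .c e f) (st i o a b (x :: c) g j q) u (m + n + 1) :=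
  Exec.iter rfl he (by simpa using h) h'

theorem exec_exit_c {e : Letter → Bool} {f : Letter → Prog Sym} :
    Exec (.loop .c e f) (st i o a b [] g j q) (st i o a b [] g j q) 1 :=
  (Exec.exit (by simp)).congr (by simp) le_rfl

theorem exec_case_inp {f : Option Letter → Prog Sym} {t : ∀ k, List (Sym k)} {n : ℕ}
    (h : Exec (f (some x)) (st i o a b c g j q) t n) :
    Exec (.case .inp f) (st (x :: i) o a b c g j q) t (n + 1) :=
  Exec.case (by simpa using h)

end Steps

/-- The exit condition of a loop that stops at the letter `x`. -/
def stopAt (x : Letter) : Letter → Bool := fun y => decide (y = x)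

/-- A word that ends with its only letter `semi`. -/
def IsItem (u : List Letter) : Prop := ∃ w, u = w ++ [.semi] ∧ Letter.semi ∉ w

theorem semi_notMem_encodeWord (w : List Bool) : Letter.semi ∉ encodeWord w := by
  simp only [encodeWord, List.mem_map, not_exists, not_and]
  rintro (_ | _) - <;> simp

theorem isItem_encodeWord (w : List Bool) : IsItem (encodeWord w ++ [.semi]) :=
  ⟨_, rfl, semi_notMem_encodeWord w⟩

theorem isItem_rat (u v : List Bool) :
    IsItem (encodeWord u ++ Letter.slash :: (encodeWord v ++ [.semi])) :=
  ⟨encodeWord u ++ Letter.slash :: encodeWord v, by simp,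
    by simp [semi_notMem_encodeWord]⟩

theorem IsItem.cons {u : List Letter} (hu : IsItem u) {x : Letter} (hx : x ≠ .semi) :
    IsItem (x :: u) := by
  obtain ⟨w, rfl, hw⟩ := hu
  exact ⟨x :: w, rfl, by simp [hw, hx.symm]⟩

theorem isItem_encodeRat (x : ℚ) : IsItem (encodeRat x) :=
  (isItem_rat _ _).cons (by split_ifs <;> simp)

/-- Copy an item from the input to the output. -/
def copyOut : Prog Sym := move .inp .out (stopAt .semi) id ⨾ .push .out .semi

/-- Copy an item from the input to the stack `a`. -/
def copyA : Prog Sym := move .inp .a (stopAt .semi) id ⨾ .push .a .semi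

/-- Copy an item from the stack `b` to the output. -/
def copyB : Prog Sym := move .b .out (stopAt .semi) id ⨾ .push .out .semi

section Copy

variable {i o a b c g j : List Letter} {q : List (Option Letter)}

theorem exec_copyOut {u : List Letter} (hu : IsItem u) :
    Exec copyOut (st (u ++ i) o a b c g j q) (st i (u.reverse ++ o) a b c g j q)
      (2 * u.length) := by
  obtain ⟨w, rfl, hw⟩ := hu
  refine ((exec_move (by decide) w (.semi :: i) _ (by simp) ?_ (by simp [stopAt])).seq
    (Exec.push _ _ _)).congr (by simp) (by simp; omega)
  intro x hx
  simp only [stopAt, decide_eq_false_iff_not]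
  rintro rfl
  exact hw hx

theorem exec_copyA {u : List Letter} (hu : IsItem u) :
    Exec copyA (st (u ++ i) o a b c g j q) (st i o (u.reverse ++ a) b c g j q)
      (2 * u.length) := by
  obtain ⟨w, rfl, hw⟩ := hu
  refine ((exec_move (by decide) w (.semi :: i) _ (by simp) ?_ (by simp [stopAt])).seq
    (Exec.push _ _ _)).congr (by simp) (by simp; omega)
  intro x hx
  simp only [stopAt, decide_eq_false_iff_not]
  rintro rfl
  exact hw hx

theorem exec_copyB {u : List Letter} (hu : IsItem u) :
    Exec copyB (st i o a (u ++ b) c g j q) (st i (u.reverse ++ o) a b c g j q)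
      (2 * u.length) := by
  obtain ⟨w, rfl, hw⟩ := hu
  refine ((exec_move (by decide) w (.semi :: b) _ (by simp) ?_ (by simp [stopAt])).seq
    (Exec.push _ _ _)).congr (by simp) (by simp; omega)
  intro x hx
  simp only [stopAt, decide_eq_false_iff_not]
  rintro rfl
  exact hw hx

end Copy

end NeuralNet

/-! ### Part i): parsing an instance and writing one query per output -/

namespace NeuralNet

open StackProgram

theorem encodeList_append {α : Type} (enc : α → List Letter) (l : List α) (r : List Letter) :
    encodeList enc l ++ r = (l.flatMap fun a => Letter.next :: enc a) ++ Letter.done :: r := by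
  simp [encodeList]

theorem length_encodeList {α : Type} (enc : α → List Letter) (l : List α) :
    (encodeList enc l).length = (l.flatMap fun a => Letter.next :: enc a).length + 1 := by
  simp [encodeList]

/-- Move an encoded list of rational numbers from the input to the stack `a`, and count its entries
on the stack `c`. -/
def readCenter : Prog Sym :=
  .loop .inp (stopAt .done) (fun _ => .push .a .next ⨾ copyA ⨾ .push .c .zero) ⨾
    .push .a .done

theorem exec_readCenter (xs : List ℚ) (i o a b c g j : List Letter) (q : List (Option Letter)) :
    Exec readCenter (st (encodeList encodeRat xs ++ i) o a b c g j q)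
      (st i o ((encodeList encodeRat xs).reverse ++ a) b
        (List.replicate xs.length Letter.zero ++ c) g j q)
      (4 * (encodeList encodeRat xs).length) := by
  rw [encodeList_append, length_encodeList]
  -- The constant `2`: an entry `x` costs two pushes and `2 * (encodeRat x).length` steps for the
  -- copy.
  refine ((exec_loop_flatMap (Γ := Sym) (k := .inp) Letter.next Letter.done rfl rfl encodeRat
    (fun d r => st r o ((d.flatMap fun a => Letter.next :: encodeRat a).reverse ++ a) b
        (List.replicate d.length Letter.zero ++ c) g j q) (fun _ _ => rfl)
        (fun _ _ _ => update_inp ..) 2 ?_ xs [] i).seq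
    (exec_push_a ..)).congr (by simp [encodeList]) (by omega)
  intro d x r
  refine ((exec_push_a ..).seq ((exec_copyA (isItem_encodeRat x)).seq (exec_push_c ..))).congr
    (by simp [List.replicate_succ]) (by omega)

/-- Move an encoded radius from the input to the stack `a`. -/
def readRadius : Prog Sym :=
  .case .inp fun
    | some .infty => .push .a .infty
    | some x => .push .a x ⨾ copyA
    | none => .skip

theorem exec_readRadius (e : WithTop ℚ≥0) (i o a b c g j : List Letter)
    (q : List (Option Letter)) :
    Exec readRadius (st (encodeRadius e ++ i) o a b c g j q)
      (st i o ((encodeRadius e).reverse ++ a) b c g j q) (2 * (encodeRadius e).length) := by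
  cases e using WithTop.recTopCoe with
  | top =>
    exact (exec_case_inp (exec_push_a ..)).congr (by simp [encodeRadius]) (by simp [encodeRadius])
  | coe e =>
    -- A finite radius begins with its sign letter, which distinguishes it from `∞`.
    have he : ∃ x, x ≠ Letter.infty ∧ ∃ u, IsItem u ∧ encodeRadius e = x :: u :=
      ⟨_, by split_ifs <;> simp, _, isItem_rat _ _, rfl⟩
    obtain ⟨x, hx, u, hu, h⟩ := he
    rw [h]
    refine (exec_case_inp (n := 1 + 2 * u.length) ?_).mono (by simp; omega)
    have : Exec (.push .a x ⨾ copyA) (st (u ++ i) o a b c g j q)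
        (st i o ((x :: u).reverse ++ a) b c g j q) (1 + 2 * u.length) :=
      ((exec_push_a ..).seq (exec_copyA hu)).congr (by simp) le_rfl
    cases x <;> first | exact this | exact absurd rfl hx

/-- Move an encoded node, without its separator, from the input to the stack `a`. -/
def readNeuron : Prog Sym :=
  copyA ⨾ copyA ⨾ .loop .inp (stopAt .done) (fun _ => .push .a .next ⨾ copyA) ⨾ .push .a .done

theorem exec_readNeuron {F : Set (ℝ → ℝ)} (name : F ↪ List Bool) {n : ℕ} (v : Neuron F n)
    (i o a b c g j : List Letter) (q : List (Option Letter)) :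
    Exec readNeuron (st (encodeNeuron name v ++ i) o a b c g j q)
      (st i o ((encodeNeuron name v).reverse ++ a) b c g j q)
      (4 * (encodeNeuron name v).length) := by
  have hv : encodeNeuron name v ++ i = (encodeWord (name v.act) ++ [Letter.semi]) ++
      (encodeRat v.bias ++ (((List.ofFn v.weight).flatMap fun x => Letter.next :: encodeRat x) ++
        Letter.done :: i)) := by
    simp [encodeNeuron, encodeTuple, encodeList]
  rw [hv]
  refine ((exec_copyA (isItem_encodeWord _)).seq ((exec_copyA (isItem_encodeRat _)).seq
    ((exec_loop_flatMap (Γ := Sym) (k := .inp) Letter.next Letter.done rfl rfl encodeRat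
      (fun d r => st r o ((d.flatMap fun a => Letter.next :: encodeRat a).reverse ++
        ((encodeRat v.bias).reverse ++ ((encodeWord (name v.act) ++ [Letter.semi]).reverse ++ a)))
        b c g j q) (fun _ _ => rfl) (fun _ _ _ => update_inp ..) 2 ?_ _ [] i).seq
    (exec_push_a ..)))).congr (by simp [encodeNeuron, encodeTuple, encodeList]) ?_
  · intro d x r
    exact ((exec_push_a ..).seq (exec_copyA (isItem_encodeRat x))).congr (by simp) (by omega)
  · simp only [encodeNeuron, encodeTuple, encodeList, List.length_append, List.length_cons,
      List.length_nil]
    omega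

/-- Move an encoded layer from the input to the stack `a`, append the letter `next`, and write the
number of its nodes to the stack `c`. -/
def readLayer : Prog Sym :=
  clear Sym .c ⨾ .loop .inp (stopAt .done) (fun _ => .push .a .next ⨾ readNeuron ⨾
    .push .c .zero) ⨾ .push .a .done ⨾ .push .a .next

theorem exec_readLayer {F : Set (ℝ → ℝ)} (name : F ↪ List Bool) {n m : ℕ} (l : Layer F n m)
    (i o a b c g j : List Letter) (q : List (Option Letter)) :
    Exec readLayer (st (encodeTuple (encodeNeuron name) l ++ i) o a b c g j q)
      (st i o (Letter.next :: ((encodeTuple (encodeNeuron name) l).reverse ++ a)) b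
        (List.replicate m Letter.zero) g j q)
      (8 * (encodeTuple (encodeNeuron name) l).length + 2 * c.length) := by
  rw [encodeTuple, encodeList_append, length_encodeList]
  refine ((exec_clear_c ..).seq ((exec_loop_flatMap (Γ := Sym) (k := .inp) Letter.next Letter.done
    rfl rfl (encodeNeuron name)
    (fun d r => st r o ((d.flatMap fun a => Letter.next :: encodeNeuron name a).reverse ++ a) b
      (List.replicate d.length Letter.zero) g j q) (fun _ _ => rfl)
      (fun _ _ _ => update_inp ..) 4 ?_ _ [] i).seq
    ((exec_push_a ..).seq (exec_push_a ..)))).congr (by simp [encodeList]) (by omega)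
  intro d x r
  exact ((exec_push_a ..).seq ((exec_readNeuron name x ..).seq (exec_push_c ..))).congr
    (by simp [List.replicate_succ]) (by omega)

/-- Every entry contributes at least its separator, and `done` ends the list. Counters of nodes and
weights are therefore no longer than the input that produced them. -/
theorem le_length_encodeTuple {α : Type} (enc : α → List Letter) {n : ℕ} (v : Fin n → α) :
    n + 1 ≤ (encodeTuple enc v).length := by
  have h : ∀ l : List α, l.length ≤ (l.flatMap fun a => Letter.next :: enc a).length := by
    intro l
    induction l with
    | nil => simp
    | cons x l ih =>
      simp only [List.flatMap_cons, List.length_append, List.length_cons]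
      omega
  have := h (List.ofFn v)
  rw [List.length_ofFn] at this
  rw [encodeTuple, length_encodeList]
  omega

/-- With an additional `next` in front, every layer is announced by `next`, and `done` ends the
loop. The program also writes `next` after the last layer, whence `dropLast`. Each layer overwrites
the counter on `c`, so the number of outputs remains at the end; clearing the counter of a layer is
paid for by the encoding of that layer. -/
theorem exec_loop_readLayer {F : Set (ℝ → ℝ)} (name : F ↪ List Bool) {n m : ℕ}
    (N : Network F n m) (i o a b c g j : List Letter) (q : List (Option Letter)) :
    Exec (.loop .inp (stopAt .done) fun _ => readLayer)
      (st (Letter.next :: (encodeNetwork name N ++ i)) o a b c g j q)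
      (st i o (Letter.next :: ((encodeNetwork name N).dropLast.reverse ++ a)) b
        (List.replicate m Letter.zero) g j q)
      (12 * (encodeNetwork name N).length + 2 * c.length) := by
  induction N generalizing a c with
  | output l =>
    have h := exec_readLayer name l (Letter.done :: i) o a b c g j q
    refine (exec_iter_inp rfl (h.congr' ?_) (exec_exit_inp rfl)).congr ?_ ?_
    · simp [encodeNetwork]
    · simp [encodeNetwork]
    · simp [encodeNetwork]
      omega
  | @hidden n k m l N ih =>
    have h := exec_readLayer name l (Letter.next :: (encodeNetwork name N ++ i)) o a b c g j q
    refine (exec_iter_inp rfl (h.congr' ?_) (ih ..)).congr ?_ ?_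
    · simp [encodeNetwork]
    · have hN : encodeNetwork name N ≠ [] := by
        cases N <;> simp [encodeNetwork, encodeTuple, encodeList]
      simp [encodeNetwork, List.dropLast_append_of_ne_nil, List.dropLast_cons_of_ne_nil hN]
    · have := le_length_encodeTuple (encodeNeuron name) l
      simp [encodeNetwork]
      omega

theorem encodeNetwork_dropLast_append {F : Set (ℝ → ℝ)} (name : F ↪ List Bool) {n m : ℕ}
    (N : Network F n m) : (encodeNetwork name N).dropLast ++ [Letter.done] =
      encodeNetwork name N := by
  induction N with
  | output l => simp [encodeNetwork]
  | hidden l N ih =>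
    have hN : encodeNetwork name N ≠ [] := by
      cases N <;> simp [encodeNetwork, encodeTuple, encodeList]
    simp [encodeNetwork, List.dropLast_append_of_ne_nil, List.dropLast_cons_of_ne_nil hN, ih]

theorem le_length_encodeNetwork {F : Set (ℝ → ℝ)} (name : F ↪ List Bool) {n m : ℕ}
    (N : Network F n m) : m ≤ (encodeNetwork name N).length := by
  induction N with
  | output l =>
    have := le_length_encodeTuple (encodeNeuron name) l
    simp [encodeNetwork]
    omega
  | hidden l N ih =>
    simp [encodeNetwork]
    omega

/-- Move an encoded network from the input to the stack `a`, and write the number of its outputs to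
the stack `c`. -/
def readNetwork : Prog Sym :=
  .push .inp .next ⨾ .loop .inp (stopAt .done) (fun _ => readLayer) ⨾
    .case .a (fun _ => .push .a .done)

theorem exec_readNetwork {F : Set (ℝ → ℝ)} (name : F ↪ List Bool) {n m : ℕ}
    (N : Network F n m) (i o a b c g j : List Letter) (q : List (Option Letter)) :
    Exec readNetwork (st (encodeNetwork name N ++ i) o a b c g j q)
      (st i o ((encodeNetwork name N).reverse ++ a) b (List.replicate m Letter.zero) g j q)
      (12 * (encodeNetwork name N).length + 2 * c.length + 3) := by
  -- The popped letter is the superfluous `next` after the last layer; `done` takes its place.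
  refine ((exec_push_inp ..).seq ((exec_loop_readLayer name N ..).seq (Exec.case (n := 1)
    ((Exec.push _ _ _).congr rfl le_rfl)))).congr ?_ (by omega)
  conv_rhs => rw [← encodeNetwork_dropLast_append name N]
  simp

/-- With the reversal of a word `w` on the stack `a` and `m` letters on the stack `c`, write the
queries that consist of `k` times the letter `one`, the letter `semi`, and `w`, for `k < m`. -/
def writeQueries : Prog Sym :=
  .loop .c (fun _ => false) fun _ =>
    .push .q none ⨾ spread .a .q .inp (fun x => [some x]) id ⨾
      move .inp .a (fun _ => false) id ⨾ .push .q (some .semi) ⨾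
      spread .c .q .b (fun _ => [some .one]) id ⨾ move .b .c (fun _ => false) id

theorem exec_push_q (i o a b c g j : List Letter) (q : List (Option Letter)) (x : Option Letter) :
    Exec (.push .q x) (st i o a b c g j q) (st i o a b c g j (x :: q)) 1 :=
  (Exec.push _ _ _).congr (by simp) le_rfl

/-- A stack is written from the bottom, so the queries are produced for decreasing `k`, each from
its last letter to its first. Popping one of `k + 1` counter letters leaves exactly `k`, which are
the unary index. The stacks `inp` and `b` serve to restore `a` and `c` after copying. -/
theorem exec_writeQueries (w : List Letter) (m : ℕ) (o g j : List Letter)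
    (q : List (Option Letter)) :
    Exec writeQueries (st [] o w.reverse [] (List.replicate m Letter.zero) g j q)
      (st [] o w.reverse [] [] g j (((List.range m).flatMap fun k =>
        (List.replicate k Letter.one ++ Letter.semi :: w).map some ++ [none]) ++ q))
      ((6 * w.length + 6 * m + 10) * m + 1) := by
  induction m generalizing q with
  | zero => exact (Exec.exit (by simp)).congr (by simp) (by simp)
  | succ m ih =>
    have h1 := (exec_spread (Γ := Sym) (k := .a) (l := .q) (l' := .inp) (by decide) (by decide)
      (by decide) (ψ := fun x => [some x]) (φ := id) (L := 1) (by simp)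
      (st [] o w.reverse [] (List.replicate m Letter.zero) g j (none :: q))).congr
      (t' := st w o [] [] (List.replicate m Letter.zero) g j (w.map some ++ none :: q))
      (by simp [← List.map_eq_flatMap]) le_rfl
    have h2 := (exec_spread (Γ := Sym) (k := .c) (l := .q) (l' := .b) (by decide) (by decide)
      (by decide) (ψ := fun _ => [some .one]) (φ := id) (L := 1) (by simp)
      (st [] o w.reverse [] (List.replicate m Letter.zero) g j
        (some .semi :: (w.map some ++ none :: q)))).congr
      (t' := st [] o w.reverse (List.replicate m Letter.zero) [] g j
        ((List.replicate m Letter.one ++ Letter.semi :: w).map some ++ none :: q))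
      (by simp [← List.map_eq_flatMap]) le_rfl
    have h3 := exec_move_inp_a w o [] [] (List.replicate m Letter.zero) g j
      (w.map some ++ none :: q)
    have h4 := exec_move_b_c [] o w.reverse (List.replicate m Letter.zero) [] g j
      ((List.replicate m Letter.one ++ Letter.semi :: w).map some ++ none :: q)
    rw [List.append_nil] at h3 h4
    rw [List.reverse_replicate] at h4
    refine (exec_iter_c rfl ((exec_push_q ..).seq (h1.seq (h3.seq ((exec_push_q ..).seq
      (h2.seq h4))))) (ih _)).congr
      ?_ ?_
    · simp [List.range_succ]
    · simp
      nlinarith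

theorem exec_queries {F : Set (ℝ → ℝ)} (name : F ↪ List Bool) (I : ArbInstance F) :
    Exec (readCenter ⨾ readRadius ⨾ readNetwork ⨾ writeQueries ⨾ clear Sym .a)
      (st (I.encode name) [] [] [] [] [] [] [])
      (st [] [] [] [] [] [] [] ((List.range I.outDim).flatMap fun k =>
        (List.replicate k Letter.one ++ Letter.semi :: I.encode name).map some ++ [none]))
      (12 * (I.encode name).length ^ 2 + 30 * (I.encode name).length + 10) := by
  obtain ⟨n, m, N, e, v⟩ := I
  have h1 := exec_readCenter (List.ofFn v) (encodeRadius e ++ (encodeNetwork name N)) [] [] [] []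
    [] [] []
  have h2 := exec_readRadius e (encodeNetwork name N) [] (encodeTuple encodeRat v).reverse []
    (List.replicate n Letter.zero) [] [] []
  have h3 := exec_readNetwork name N [] [] ((encodeRadius e).reverse ++
    (encodeTuple encodeRat v).reverse) [] (List.replicate n Letter.zero) [] [] []
  have h4 := exec_writeQueries (ArbInstance.encode name ⟨n, m, N, e, v⟩) m [] [] [] []
  simp only [List.append_nil, List.length_ofFn] at h1 h3 h4
  rw [← encodeTuple] at h1
  have hm := le_length_encodeNetwork name N
  have hn := le_length_encodeTuple encodeRat v
  have hw : (ArbInstance.encode name ⟨n, m, N, e, v⟩).length = (encodeTuple encodeRat v).length +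
      ((encodeRadius e).length + (encodeNetwork name N).length) := by
    simp [ArbInstance.encode]
  refine (h1.seq (h2.seq (h3.seq ((h4.congr' ?_).seq (exec_clear_a ..))))).congr rfl ?_
  · simp [ArbInstance.encode]
  · have h5 : m ≤ (ArbInstance.encode name ⟨n, m, N, e, v⟩).length := by omega
    simp only [List.length_reverse, List.length_replicate]
    generalize (ArbInstance.encode name ⟨n, m, N, e, v⟩).length = L at hw h5 ⊢
    have h6 : (6 * L + 6 * m + 10) * m ≤ (12 * L + 10) * L := Nat.mul_le_mul (by omega) h5
    have h7 : (12 * L + 10) * L = 12 * L ^ 2 + 10 * L := by ring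
    omega

theorem exists_isDisjunctiveReduction (F : Set (ℝ → ℝ)) (name : F ↪ List Bool)
    (d : ∀ n : ℕ, MetricSpace (Fin n → ℝ)) :
    ∃ f : ArbInstance F → List (ClassInstance F),
      IsDisjunctiveReduction (aCR F name d) (CR F name d) f := by
  refine ⟨fun I => (List.finRange I.outDim).map fun j => ⟨I, j⟩, ?_, ?_⟩
  · refine computableInPolyTime_of_exec (Γ := Sym)
      (readCenter ⨾ readRadius ⨾ readNetwork ⨾ writeQueries ⨾ clear Sym .a)
      .inp .q _ _ _ (12 * .X ^ 2 + 30 * .X + 10) fun I => ?_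
    have h := exec_queries name I
    rw [st_nil_inp, st_nil_q] at h
    refine h.congr ?_ ?_
    · congr 1
      change _ = List.flatMap _ _
      rw [← List.map_coe_finRange_eq_range, List.flatMap_map]
      exact (List.flatMap_map (fun j => (⟨I, j⟩ : ClassInstance F))
        (fun J => (J.encode name).map some ++ [none]) _).symm
    · simp [aCR]
  · intro I
    simp only [aCR, CR, ArbClassRobust]
    constructor
    · rintro ⟨j, hj⟩
      exact ⟨⟨I, j⟩, List.mem_map.2 ⟨j, List.mem_finRange j, rfl⟩, hj⟩
    · rintro ⟨J, hJ, h⟩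
      obtain ⟨j, -, rfl⟩ := List.mem_map.1 hJ
      exact ⟨j, h⟩

end NeuralNet

/-! ### Part ii): the lifted network and the comparison of three outputs -/

namespace NeuralNet

section Lift

variable {F : Set (ℝ → ℝ)} (h : ReLU ∈ F)

/-- A `ReLU` node without bias. -/
noncomputable def reluNeuron {n : ℕ} (w : Fin n → ℚ) : Neuron F n := ⟨⟨ReLU, h⟩, w, 0⟩

/-- Prefix a vector with two entries. -/
def cons₂ {α : Type} {n : ℕ} (x y : α) (v : Fin n → α) : Fin (n + 2) → α :=
  Fin.cons x (Fin.cons y v)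

/-- Change the sign of the entries of a vector at the places of `true` in the list `s`. -/
def flipSigns {R : Type} [Neg R] (s : List Bool) {n : ℕ} (v : Fin n → R) : Fin n → R :=
  fun i => if s[(i : ℕ)]? = some true then -v i else v i

/-- Two nodes that pass on the first two, nonnegative, inputs, followed by the nodes `l`. -/
noncomputable def passLayer {n k : ℕ} (l : Layer F (n + 2) k) : Layer F (n + 2) (k + 2) :=
  cons₂ (reluNeuron h (cons₂ 1 0 0)) (reluNeuron h (cons₂ 0 1 0)) l

/-- Add two inputs of weight zero to a node, and change the signs of weights according to `s`. -/
def liftNeuron (s : List Bool) {n : ℕ} (v : Neuron F n) : Neuron F (n + 2) :=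
  ⟨v.act, cons₂ 0 0 (flipSigns s v.weight), v.bias⟩

/-- Add two nodes to every layer of a network that pass on two additional inputs, change the signs
of the inputs according to `s`, and continue with the network `T`. -/
noncomputable def liftNetwork : {n m : ℕ} → List Bool → Network F n m → {m' : ℕ} → Network F (m + 2) m' →
    Network F (n + 2) m'
  | _, _, s, .output l, _, T => .hidden (passLayer h fun i => liftNeuron s (l i)) T
  | _, _, s, .hidden l N, _, T =>
      .hidden (passLayer h fun i => liftNeuron s (l i)) (liftNetwork [] N T)

/-- The node that computes `ReLU (y i - y j)`. -/
noncomputable def diffNeuron {m : ℕ} (j i : Fin m) : Neuron F (m + 2) :=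
  reluNeuron h (cons₂ 0 0 fun l =>
    if l = i then (if l = j then 0 else 1) else if l = j then -1 else 0)

/-- From the inputs `t₁, t₂ ≥ 0` and `y`, compute `ReLU (t₁ - t₂ + z)`, `ReLU (t₂ - t₁ + z)` and
`ReLU (t₁ + t₂)` for the sum `z` of the numbers `ReLU (y i - y j)`. -/
noncomputable def compareNetwork {m : ℕ} (j : Fin m) : Network F (m + 2) 3 :=
  .hidden (passLayer h (diffNeuron h j))
    (.output ![reluNeuron h (cons₂ 1 (-1) 1), reluNeuron h (cons₂ (-1) 1 1),
      reluNeuron h (cons₂ 1 1 0)])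

theorem ReLU_of_nonneg {x : ℝ} (hx : 0 ≤ x) : ReLU x = x := max_eq_right hx

theorem ReLU_nonneg (x : ℝ) : 0 ≤ ReLU x := le_max_left _ _

@[simp] theorem ReLU_ReLU (x : ℝ) : ReLU (ReLU x) = ReLU x := ReLU_of_nonneg (ReLU_nonneg x)

theorem cons₂_eta {α : Type} {n : ℕ} (z : Fin (n + 2) → α) :
    cons₂ (z 0) (z 1) (fun i => z i.succ.succ) = z := by
  funext i
  refine Fin.cases rfl (fun i => ?_) i
  exact Fin.cases rfl (fun i => rfl) i

theorem sum_cons₂ {n : ℕ} (a b : ℚ) (w : Fin n → ℚ) (x y : ℝ) (v : Fin n → ℝ) :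
    ∑ i, ((cons₂ a b w i : ℚ) : ℝ) * cons₂ x y v i = a * x + (b * y + ∑ i, (w i : ℝ) * v i) := by
  rw [Fin.sum_univ_succ, Fin.sum_univ_succ]
  rfl

/-- A sign moves from a weight to the value it multiplies, so changing weights in one layer amounts
to changing the signs of its inputs. -/
theorem flipSigns_mul (s : List Bool) {n : ℕ} (w : Fin n → ℚ) (v : Fin n → ℝ) (i : Fin n) :
    ((flipSigns s w i : ℚ) : ℝ) * v i = w i * flipSigns s v i := by
  simp only [flipSigns]
  split_ifs <;> simp

@[simp] theorem flipSigns_nil {R : Type} [Neg R] {n : ℕ} (v : Fin n → R) :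
    flipSigns [] v = v := by
  funext i
  simp [flipSigns]

theorem eval_reluNeuron {n : ℕ} (a b : ℚ) (w : Fin n → ℚ) (x y : ℝ) (v : Fin n → ℝ) :
    (reluNeuron h (cons₂ a b w)).eval (cons₂ x y v) =
      ReLU (a * x + (b * y + ∑ i, (w i : ℝ) * v i)) := by
  rw [← sum_cons₂]
  simp [reluNeuron, Neuron.eval]

theorem eval_passLayer {n k : ℕ} (l : Layer F (n + 2) k) (x y : ℝ) (v : Fin n → ℝ) :
    (fun i => (passLayer h l i).eval (cons₂ x y v)) =
      cons₂ (ReLU x) (ReLU y) fun i => (l i).eval (cons₂ x y v) := by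
  funext i
  refine Fin.cases ?_ (fun i => Fin.cases ?_ (fun i => rfl) i) i
  · exact (eval_reluNeuron ..).trans (by simp [cons₂])
  · exact (eval_reluNeuron ..).trans (by simp [cons₂])

theorem eval_liftNeuron (s : List Bool) {n : ℕ} (v : Neuron F n) (x y : ℝ) (u : Fin n → ℝ) :
    (liftNeuron s v).eval (cons₂ x y u) = v.eval (flipSigns s u) := by
  simp only [Neuron.eval, liftNeuron]
  rw [sum_cons₂]
  simp [flipSigns_mul]

/-- ReLU is idempotent, so the two extra values stay fixed after the first layer. The signs matter
only in that layer; all later ones are lifted with the empty list. -/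
theorem eval_liftNetwork (s : List Bool) {n m m' : ℕ} (N : Network F n m)
    (T : Network F (m + 2) m') (x y : ℝ) (u : Fin n → ℝ) :
    (liftNetwork h s N T).eval (cons₂ x y u) =
      T.eval (cons₂ (ReLU x) (ReLU y) (N.eval (flipSigns s u))) := by
  induction N generalizing s x y with
  | output l => simp only [liftNetwork, Network.eval, eval_passLayer, eval_liftNeuron]
  | hidden l N ih =>
    simp only [liftNetwork, Network.eval, eval_passLayer, eval_liftNeuron, ih, ReLU_ReLU,
      flipSigns_nil]

/-- The amount by which `y j` fails to be maximal. -/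
noncomputable def excess {m : ℕ} (j : Fin m) (y : Fin m → ℝ) : ℝ := ∑ i, ReLU (y i - y j)

theorem excess_nonneg {m : ℕ} (j : Fin m) (y : Fin m → ℝ) : 0 ≤ excess j y :=
  Finset.sum_nonneg fun _ _ => ReLU_nonneg _

theorem excess_eq_zero {m : ℕ} (j : Fin m) (y : Fin m → ℝ) :
    excess j y = 0 ↔ ∀ i, y i ≤ y j := by
  rw [excess, Finset.sum_eq_zero_iff_of_nonneg fun _ _ => ReLU_nonneg _]
  simp [ReLU]

theorem eval_diffNeuron {m : ℕ} (j i : Fin m) (x y : ℝ) (v : Fin m → ℝ) :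
    (diffNeuron h j i).eval (cons₂ x y v) = ReLU (v i - v j) := by
  refine (eval_reluNeuron ..).trans (congrArg ReLU ?_)
  -- Each weight is a difference of two indicators, also for `i = j`, where they cancel.
  have : ∀ l, (((if l = i then (if l = j then 0 else 1) else if l = j then -1 else 0 : ℚ)) : ℝ) *
      v l = (if l = i then v l else 0) - (if l = j then v l else 0) := by
    intro l
    split_ifs <;> simp
  simp only [this, Finset.sum_sub_distrib, Finset.sum_ite_eq', Finset.mem_univ, if_true]
  simp

theorem eval_compareNetwork {m : ℕ} (j : Fin m) {x y : ℝ} (hx : 0 ≤ x) (hy : 0 ≤ y)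
    (v : Fin m → ℝ) : (compareNetwork h j).eval (cons₂ x y v) =
      ![ReLU (x - y + excess j v), ReLU (y - x + excess j v), x + y] := by
  simp only [compareNetwork, Network.eval, eval_passLayer, eval_diffNeuron]
  rw [ReLU_of_nonneg hx, ReLU_of_nonneg hy]
  funext i
  fin_cases i
  · refine (eval_reluNeuron ..).trans (congrArg ReLU ?_)
    simp [excess]
    ring
  · refine (eval_reluNeuron ..).trans (congrArg ReLU ?_)
    simp [excess]
    ring
  · refine (eval_reluNeuron ..).trans ?_
    simpa using ReLU_of_nonneg (add_nonneg hx hy)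

/-- The three values of `compareNetwork` have a common maximizer on `B` if and only if `excess`
vanishes, provided that `excess` is only evaluated at points with `t₁ = t₂ = 0` in `B`, and `t₁` and
`t₂` can be compared both ways. -/
theorem exists_forall_le_iff {Z : Type} (B : Set Z) (t₁ t₂ e : Z → ℝ)
    (ht₁ : ∀ z, 0 ≤ t₁ z) (ht₂ : ∀ z, 0 ≤ t₂ z) (he : ∀ z, 0 ≤ e z)
    (h₀ : ∀ z ∈ B, ∃ z' ∈ B, t₁ z' = 0 ∧ t₂ z' = 0 ∧ e z' = e z)
    (h₁ : ∃ z ∈ B, t₁ z < t₂ z) (h₂ : ∃ z ∈ B, t₂ z < t₁ z) :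
    (∃ j : Fin 3, ∀ z ∈ B, ∀ i, (![ReLU (t₁ z - t₂ z + e z), ReLU (t₂ z - t₁ z + e z),
      t₁ z + t₂ z] : Fin 3 → ℝ) i ≤ (![ReLU (t₁ z - t₂ z + e z), ReLU (t₂ z - t₁ z + e z),
      t₁ z + t₂ z] : Fin 3 → ℝ) j) ↔ ∀ z ∈ B, e z = 0 := by
  constructor
  · rintro ⟨j, hj⟩
    fin_cases j
    -- Where `t₁ < t₂`, the second output is positive and larger than the first.
    · obtain ⟨z, hz, hlt⟩ := h₁
      have h1 := hj z hz 1
      have h2 := hj z hz 2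
      simp only [ReLU, Matrix.cons_val, Fin.zero_eta] at h1 h2
      have := he z
      have := ht₁ z
      rcases max_cases 0 (t₁ z - t₂ z + e z) with h | h <;>
      rcases max_cases 0 (t₂ z - t₁ z + e z) with h' | h' <;> linarith
    · obtain ⟨z, hz, hlt⟩ := h₂
      have h1 := hj z hz 0
      have h2 := hj z hz 2
      simp only [ReLU, Matrix.cons_val, Fin.mk_one] at h1 h2
      have := he z
      have := ht₂ z
      rcases max_cases 0 (t₁ z - t₂ z + e z) with h | h <;>
      rcases max_cases 0 (t₂ z - t₁ z + e z) with h' | h' <;> linarith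
    -- Moving to `t₁ = t₂ = 0` keeps `e` and makes the third output zero, while the first becomes
    -- `e`.
    · intro z hz
      obtain ⟨z', hz', h1, h2, h3⟩ := h₀ z hz
      have h4 := hj z' hz' 0
      simp only [ReLU, Matrix.cons_val, Fin.reduceFinMk, h1, h2, h3] at h4
      have := le_max_right 0 (0 - 0 + e z)
      have := he z
      linarith
  · intro h
    -- With `e = 0`, the first two outputs are the positive parts of `±(t₁ - t₂)`, which `t₁ + t₂`
    -- dominates.
    refine ⟨2, fun z hz i => ?_⟩
    have := ht₁ z
    have := ht₂ z
    fin_cases i <;> simp [ReLU, h z hz] <;> constructor <;> linarith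

end Lift

/-! ### p-norms under insertion and removal of two coordinates -/

section Norm

open scoped ENNReal

/-- Removing coordinates shrinks the supremum (`p = ∞`) or the sum of `p`-th powers (`p < ∞`). Hence
points of a ball in the extended space project into the original ball. -/
theorem norm_toLp_le {p : ℝ≥0∞} (hp : 1 ≤ p) {n : ℕ} (x y : ℝ) (v : Fin n → ℝ) :
    ‖WithLp.toLp p v‖ ≤ ‖WithLp.toLp p (cons₂ x y v)‖ := by
  rcases eq_or_ne p ∞ with rfl | hp'
  · have : Fact ((1 : ℝ≥0∞) ≤ ∞) := ⟨hp⟩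
    rw [PiLp.norm_eq_ciSup]
    refine Real.iSup_le (fun i => ?_) (norm_nonneg _)
    exact PiLp.norm_apply_le (WithLp.toLp ∞ (cons₂ x y v)) i.succ.succ
  · have hp₀ : 0 < p.toReal := ENNReal.toReal_pos (by positivity) hp'
    rw [PiLp.norm_eq_sum hp₀, PiLp.norm_eq_sum hp₀]
    refine Real.rpow_le_rpow (by positivity) ?_ (by positivity)
    rw [Fin.sum_univ_succ, Fin.sum_univ_succ]
    have h1 := Real.rpow_nonneg (norm_nonneg x) p.toReal
    have h2 := Real.rpow_nonneg (norm_nonneg y) p.toReal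
    simp only [cons₂, Fin.cons_succ, Fin.cons_zero]
    linarith

/-- The original ball embeds isometrically at `t₁ = t₂ = 0`; zeros affect neither the supremum nor,
as `p > 0`, the sum. -/
theorem norm_toLp_cons₂_zero {p : ℝ≥0∞} (hp : 1 ≤ p) {n : ℕ} (v : Fin n → ℝ) :
    ‖WithLp.toLp p (cons₂ 0 0 v)‖ = ‖WithLp.toLp p v‖ := by
  refine le_antisymm ?_ (norm_toLp_le hp ..)
  rcases eq_or_ne p ∞ with rfl | hp'
  · have : Fact ((1 : ℝ≥0∞) ≤ ∞) := ⟨hp⟩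
    rw [PiLp.norm_eq_ciSup]
    refine Real.iSup_le (fun i => ?_) (norm_nonneg _)
    refine Fin.cases ?_ (fun i => Fin.cases ?_ (fun i => ?_) i) i
    · simp [cons₂]
    · simp [cons₂]
    · exact PiLp.norm_apply_le (WithLp.toLp ∞ v) i
  · have hp₀ : 0 < p.toReal := ENNReal.toReal_pos (by positivity) hp'
    rw [PiLp.norm_eq_sum hp₀, PiLp.norm_eq_sum hp₀]
    refine Real.rpow_le_rpow (by positivity) ?_ (by positivity)
    rw [Fin.sum_univ_succ, Fin.sum_univ_succ]
    simp [cons₂, Real.zero_rpow hp₀.ne']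

theorem exists_smul_norm_le {p : ℝ≥0∞} (hp : 1 ≤ p) {n : ℕ} (v : Fin n → ℝ) {ε : ℝ}
    (hε : 0 < ε) : ∃ δ : ℝ, 0 < δ ∧ ‖WithLp.toLp p (δ • v)‖ ≤ ε := by
  have : Fact (1 ≤ p) := ⟨hp⟩
  have hpos : 0 < ‖WithLp.toLp p v‖ + 1 := by positivity
  -- The summand `1` covers `v = 0`.
  refine ⟨ε / (‖WithLp.toLp p v‖ + 1), by positivity, ?_⟩
  rw [WithLp.toLp_smul, norm_smul, Real.norm_of_nonneg (by positivity), div_mul_eq_mul_div,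
    div_le_iff₀ hpos]
  exact mul_le_mul_of_nonneg_left (by linarith) hε.le

end Norm

end NeuralNet

/-! ### Correctness of the reduction from `CR` to `aCR` -/

namespace NeuralNet

section Instances

variable {F : Set (ℝ → ℝ)} (h : ReLU ∈ F)

/-- The layer that computes `ReLU (t₁)`, `ReLU (t₂)` and the constants `|v i|`. -/
noncomputable def constLayer {n : ℕ} (v : Fin n → ℚ) : Layer F (0 + 2) (n + 2) :=
  passLayer h fun i => ⟨⟨ReLU, h⟩, cons₂ 0 0 0, |v i|⟩

/-- The list of signs of a vector. -/
def signs {n : ℕ} (v : Fin n → ℚ) : List Bool := List.ofFn fun i => decide (v i < 0)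

/-- The reduction from `CR` to `aCR` for radius zero. -/
noncomputable def toArbOfZero (I : ClassInstance F) : ArbInstance F where
  inDim := 0 + 2
  outDim := 3
  net := .hidden (constLayer h I.center)
    (liftNetwork h (signs I.center) I.net (compareNetwork h I.index))
  eps := 1
  center := cons₂ 0 0 0

/-- The reduction from `CR` to `aCR` for a positive radius. -/
noncomputable def toArbOfPos (I : ClassInstance F) : ArbInstance F where
  inDim := I.inDim + 2
  outDim := 3
  net := liftNetwork h [] I.net (compareNetwork h I.index)
  eps := I.eps
  center := cons₂ 0 0 I.center

/-- The reduction from `CR` to `aCR`. -/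
noncomputable def toArb (I : ClassInstance F) : ArbInstance F :=
  if I.eps = 0 then toArbOfZero h I else toArbOfPos h I

theorem outDim_toArb (I : ClassInstance F) : (toArb h I).outDim = 3 := by
  unfold toArb
  split_ifs <;> rfl

theorem eval_constLayer {n : ℕ} (v : Fin n → ℚ) (x y : ℝ) (u : Fin 0 → ℝ) :
    (fun i => (constLayer h v i).eval (cons₂ x y u)) =
      cons₂ (ReLU x) (ReLU y) fun i => |(v i : ℝ)| := by
  rw [constLayer, eval_passLayer]
  congr 1
  funext i
  simp only [Neuron.eval, sum_cons₂]
  simp [ReLU]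

/-- ReLU nodes can only produce the absolute values of the center; the signs, applied in the next
layer, restore it. -/
theorem flipSigns_signs {n : ℕ} (v : Fin n → ℚ) :
    (flipSigns (signs v) fun i => |(v i : ℝ)|) = fun i => (v i : ℝ) := by
  funext i
  simp only [flipSigns, signs, List.getElem?_ofFn, i.isLt, dite_true, Option.some.injEq,
    decide_eq_true_eq]
  split_ifs with hi
  · rw [abs_of_neg (by exact_mod_cast hi), neg_neg]
  · exact abs_of_nonneg (by exact_mod_cast not_lt.1 hi)

theorem classRobust_iff {d : ∀ n : ℕ, MetricSpace (Fin n → ℝ)} {n m : ℕ} (N : Network F n m)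
    (ε : WithTop ℚ≥0) (xbar : Fin n → ℝ) (j : Fin m) :
    ClassRobust d N ε xbar j ↔
      ∀ x, (∀ e : ℚ≥0, ε = (e : WithTop ℚ≥0) → (d n).dist x xbar ≤ (e : ℝ)) →
        excess j (N.eval x) = 0 := by
  simp only [ClassRobust, excess_eq_zero]

theorem cast_cons₂ {n : ℕ} (x y : ℚ) (v : Fin n → ℚ) :
    (fun i => ((cons₂ x y v i : ℚ) : ℝ)) = cons₂ (x : ℝ) (y : ℝ) fun i => (v i : ℝ) := by
  funext i
  exact Fin.cases rfl (fun i => Fin.cases rfl (fun i => rfl) i) i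

theorem cons₂_sub {n : ℕ} (x y x' y' : ℝ) (v v' : Fin n → ℝ) :
    cons₂ x y v - cons₂ x' y' v' = cons₂ (x - x') (y - y') (v - v') := by
  funext i
  exact Fin.cases rfl (fun i => Fin.cases rfl (fun i => rfl) i) i

theorem smul_cons₂ {n : ℕ} (c x y : ℝ) (v : Fin n → ℝ) :
    c • cons₂ x y v = cons₂ (c * x) (c * y) (c • v) := by
  funext i
  exact Fin.cases rfl (fun i => Fin.cases rfl (fun i => rfl) i) i

theorem exists_pos_le_radius {ε : WithTop ℚ≥0} (hε : ε ≠ 0) :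
    ∃ r : ℝ, 0 < r ∧ ∀ e : ℚ≥0, ε = (e : WithTop ℚ≥0) → r ≤ e := by
  cases ε using WithTop.recTopCoe with
  | top => exact ⟨1, one_pos, by simp⟩
  | coe e =>
    refine ⟨e, ?_, ?_⟩
    · have : e ≠ 0 := fun he => hε (by simp [he])
      exact_mod_cast pos_iff_ne_zero.2 this
    · rintro e' he'
      rw [WithTop.coe_inj.1 he']

/-- For a metric that comes from a `p`-norm, small multiples of a vector, added to the center, do
not leave a ball of positive radius. -/
theorem exists_cons₂_mem_ball {d : ∀ n : ℕ, MetricSpace (Fin n → ℝ)} (hd : IsPNormMetric d)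
    {ε : WithTop ℚ≥0} (hε : ε ≠ 0) {n : ℕ} (v : Fin n → ℝ) (x y : ℝ) :
    ∃ δ : ℝ, 0 < δ ∧ ∀ e : ℚ≥0, ε = (e : WithTop ℚ≥0) →
      (d (n + 2)).dist (cons₂ (δ * x) (δ * y) v) (cons₂ 0 0 v) ≤ (e : ℝ) := by
  obtain ⟨p, hp, hd⟩ := hd
  obtain ⟨r, hr, hr'⟩ := exists_pos_le_radius hε
  obtain ⟨δ, hδ, hδ'⟩ := exists_smul_norm_le hp (cons₂ x y (0 : Fin n → ℝ)) hr
  refine ⟨δ, hδ, fun e he => ?_⟩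
  rw [hd, cons₂_sub]
  rw [smul_cons₂] at hδ'
  simpa using hδ'.trans (hr' e he)

/-- Transfers `exists_forall_le_iff` to balls: inserting zeros and dropping coordinates map the two
balls into each other, and `ε ≠ 0` provides points with either strict order of `t₁` and `t₂`. The
function `f` is kept abstract because it is the excess of the network for a positive radius, but a
constant on `ℝ⁰` for radius zero. -/
theorem arbClassRobust_iff_of_eval {d : ∀ n : ℕ, MetricSpace (Fin n → ℝ)} (hd : IsPNormMetric d)
    {ε : WithTop ℚ≥0} (hε : ε ≠ 0) {n : ℕ} (N : Network F (n + 2) 3) (v : Fin n → ℝ)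
    (f : (Fin n → ℝ) → ℝ) (hf : ∀ x, 0 ≤ f x)
    (hN : ∀ x y u, N.eval (cons₂ x y u) = ![ReLU (ReLU x - ReLU y + f u),
      ReLU (ReLU y - ReLU x + f u), ReLU x + ReLU y]) :
    ArbClassRobust d N ε (cons₂ 0 0 v) ↔
      ∀ x, (∀ e : ℚ≥0, ε = (e : WithTop ℚ≥0) → (d n).dist x v ≤ (e : ℝ)) → f x = 0 := by
  have hball₀ : ∀ x : Fin n → ℝ, (d (n + 2)).dist (cons₂ 0 0 x) (cons₂ 0 0 v) = (d n).dist x v := by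
    obtain ⟨p, hp, hd⟩ := hd
    intro x
    rw [hd, hd, cons₂_sub, sub_zero, norm_toLp_cons₂_zero hp]
  have hball : ∀ z : Fin (n + 2) → ℝ,
      (d n).dist (fun i => z i.succ.succ) v ≤ (d (n + 2)).dist z (cons₂ 0 0 v) := by
    obtain ⟨p, hp, hd⟩ := hd
    intro z
    conv_rhs => rw [← cons₂_eta z]
    rw [hd, hd, cons₂_sub]
    exact norm_toLp_le hp ..
  have hN' : ∀ z, N.eval z = ![ReLU (ReLU (z 0) - ReLU (z 1) + f fun i => z i.succ.succ),
      ReLU (ReLU (z 1) - ReLU (z 0) + f fun i => z i.succ.succ), ReLU (z 0) + ReLU (z 1)] := by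
    intro z
    rw [← hN, cons₂_eta]
  have key := exists_forall_le_iff
    {z | ∀ e : ℚ≥0, ε = (e : WithTop ℚ≥0) → (d (n + 2)).dist z (cons₂ 0 0 v) ≤ (e : ℝ)}
    (fun z => ReLU (z 0)) (fun z => ReLU (z 1)) (fun z => f fun i => z i.succ.succ)
    (fun _ => ReLU_nonneg _) (fun _ => ReLU_nonneg _) (fun _ => hf _)
    (fun z hz => ⟨cons₂ 0 0 fun i => z i.succ.succ,
      fun e he => (hball₀ _).trans_le ((hball z).trans (hz e he)), ReLU_of_nonneg le_rfl,
      ReLU_of_nonneg le_rfl, rfl⟩) ?_ ?_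
  · simp only [ArbClassRobust, ClassRobust, hN']
    refine key.trans ⟨fun hz x hx => ?_, fun hx z hz => hx _ fun e he => (hball z).trans (hz e he)⟩
    exact hz (cons₂ 0 0 x) fun e he => (hball₀ x).trans_le (hx e he)
  · obtain ⟨δ, hδ, hz⟩ := exists_cons₂_mem_ball hd hε v 0 1
    refine ⟨_, hz, ?_⟩
    change ReLU (δ * 0) < ReLU (δ * 1)
    simpa [ReLU] using hδ
  · obtain ⟨δ, hδ, hz⟩ := exists_cons₂_mem_ball hd hε v 1 0
    refine ⟨_, hz, ?_⟩
    change ReLU (δ * 0) < ReLU (δ * 1)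
    simpa [ReLU] using hδ

theorem holds_toArb {d : ∀ n : ℕ, MetricSpace (Fin n → ℝ)} (hd : IsPNormMetric d)
    (I : ClassInstance F) :
    ClassRobust d I.net I.eps (fun i => (I.center i : ℝ)) I.index ↔
      ArbClassRobust d (toArb h I).net (toArb h I).eps (fun i => ((toArb h I).center i : ℝ)) := by
  rw [classRobust_iff]
  by_cases hε : I.eps = 0
  · rw [show toArb h I = toArbOfZero h I from if_pos hε]
    simp only [toArbOfZero, cast_cons₂, Rat.cast_zero]
    rw [arbClassRobust_iff_of_eval hd one_ne_zero _ _
      (fun _ => excess I.index (I.net.eval fun i => (I.center i : ℝ)))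
      (fun _ => excess_nonneg _ _)]
    · rw [hε]
      constructor
      · intro hx _ _
        refine hx _ fun e he => ?_
        have h0 := (d I.inDim).dist_self fun i => (I.center i : ℝ)
        exact h0.trans_le (by positivity)
      · intro hx x hx'
        have h0 : x = fun i => (I.center i : ℝ) := by
          refine (d I.inDim).eq_of_dist_eq_zero (le_antisymm ?_ ?_)
          · simpa using hx' 0 rfl
          · exact @dist_nonneg _ (d I.inDim).toPseudoMetricSpace _ _
        rw [h0]
        -- The condition on the constant is extracted at the center, the only point of `ℝ⁰`.
        refine hx (fun i => ((0 : Fin 0 → ℚ) i : ℝ)) fun e he => ?_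
        have h1 := (d 0).dist_self fun i => ((0 : Fin 0 → ℚ) i : ℝ)
        exact h1.trans_le (by positivity)
    · intro x y u
      rw [Network.eval, eval_constLayer, eval_liftNetwork, flipSigns_signs, ReLU_ReLU, ReLU_ReLU,
        eval_compareNetwork h _ (ReLU_nonneg _) (ReLU_nonneg _)]
  · rw [show toArb h I = toArbOfPos h I from if_neg hε]
    simp only [toArbOfPos, cast_cons₂, Rat.cast_zero]
    rw [arbClassRobust_iff_of_eval hd hε _ _ (fun x => excess I.index (I.net.eval x))
      (fun _ => excess_nonneg _ _)]
    intro x y u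
    rw [eval_liftNetwork, flipSigns_nil,
      eval_compareNetwork h _ (ReLU_nonneg _) (ReLU_nonneg _)]

end Instances

end NeuralNet

/-! ### Programs that write the layers of the lifted network -/

namespace NeuralNet

open StackProgram

section Steps

variable {i o a b c g j : List Letter} {q : List (Option Letter)} {x : Letter}

theorem exec_case_g {f : Option Letter → Prog Sym} {t : ∀ k, List (Sym k)} {n : ℕ}
    (h : Exec (f (some x)) (st i o a b c g j q) t n) :
    Exec (.case .g f) (st i o a b c (x :: g) j q) t (n + 1) :=
  Exec.case (by simpa using h)

theorem exec_case_g_nil {f : Option Letter → Prog Sym} {t : ∀ k, List (Sym k)} {n : ℕ}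
    (h : Exec (f none) (st i o a b c [] j q) t n) :
    Exec (.case .g f) (st i o a b c [] j q) t (n + 1) :=
  Exec.case (by simpa using h)

theorem exec_case_b {f : Option Letter → Prog Sym} {t : ∀ k, List (Sym k)} {n : ℕ}
    (h : Exec (f (some x)) (st i o a b c g j q) t n) :
    Exec (.case .b f) (st i o a (x :: b) c g j q) t (n + 1) :=
  Exec.case (by simpa using h)

theorem exec_case_c {f : Option Letter → Prog Sym} {t : ∀ k, List (Sym k)} {n : ℕ}
    (h : Exec (f (some x)) (st i o a b c g j q) t n) :
    Exec (.case .c f) (st i o a b (x :: c) g j q) t (n + 1) :=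
  Exec.case (by simpa using h)

theorem exec_spread_c_out_b {ψ : Letter → List Letter} {L : ℕ} (hL : ∀ x, (ψ x).length ≤ L) :
    Exec (spread .c .out .b ψ id) (st i o a b c g j q)
      (st i ((c.flatMap ψ).reverse ++ o) a (c.reverse ++ b) [] g j q)
      ((L + 3) * c.length + 1) :=
  (exec_spread (Γ := Sym) (by decide) (by decide) (by decide) hL _).congr (by simp) le_rfl

theorem exec_spread_b_out_a {ψ : Letter → List Letter} {L : ℕ} (hL : ∀ x, (ψ x).length ≤ L) :
    Exec (spread .b .out .a ψ id) (st i o a b c g j q)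
      (st i ((b.flatMap ψ).reverse ++ o) (b.reverse ++ a) [] c g j q)
      ((L + 3) * b.length + 1) :=
  (exec_spread (Γ := Sym) (by decide) (by decide) (by decide) hL _).congr (by simp) le_rfl

end Steps

section Words

/-- An entry of an encoded list of rational numbers. -/
def entry (x : ℚ) : List Letter := .next :: encodeRat x

theorem encodeList_encodeRat (xs : List ℚ) :
    encodeList encodeRat xs = xs.flatMap entry ++ [.done] := rfl

theorem length_entry_zero : (entry 0).length = 5 := by
  simp [entry, encodeRat, encodeWord]

theorem length_entry_one : (entry 1).length = 6 := by
  simp [entry, encodeRat, encodeWord]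

theorem length_entry_neg_one : (entry (-1)).length = 6 := by
  simp [entry, encodeRat, encodeWord]

theorem encodeRat_zero : encodeRat 0 = [.zero, .slash, .one, .semi] := by
  simp [encodeRat, encodeWord]

/-- The beginning of the encoding of a `ReLU` node without bias, as an entry of a list. -/
def nodeHead (w : List Bool) : List Letter :=
  .next :: (encodeWord w ++ .semi :: encodeRat 0)

theorem length_nodeHead (w : List Bool) : (nodeHead w).length = w.length + 6 := by
  simp [nodeHead, encodeRat_zero, encodeWord]

theorem encodeTuple_cons₂ {α : Type} (enc : α → List Letter) {n : ℕ} (x y : α) (v : Fin n → α) :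
    encodeTuple enc (cons₂ x y v) =
      Letter.next :: (enc x ++ Letter.next :: (enc y ++ encodeTuple enc v)) := by
  simp [encodeTuple, encodeList, cons₂, List.ofFn_succ]

variable {F : Set (ℝ → ℝ)} (name : F ↪ List Bool) (h : ReLU ∈ F)

theorem encodeNeuron_reluNeuron {n : ℕ} (w : Fin n → ℚ) :
    Letter.next :: encodeNeuron name (reluNeuron h w) =
      nodeHead (name ⟨ReLU, h⟩) ++ encodeTuple encodeRat w := by
  simp [encodeNeuron, reluNeuron, nodeHead]

theorem encodeTuple_const (n : ℕ) (z : ℚ) : encodeTuple encodeRat (fun _ : Fin n => z) =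
    (List.replicate n z).flatMap entry ++ [Letter.done] := by
  rw [encodeTuple, List.ofFn_const]
  rfl

/-- The first letters of a nonzero rational number, which are the only ones that depend on its
sign. -/
theorem exists_encodeRat_eq {x : ℚ} (hx : x ≠ 0) :
    ∃ (s : Bool) (l : Letter) (u : List Letter), l ≠ .slash ∧ IsItem u ∧
      encodeRat x = cond s .one .zero :: l :: u ∧ encodeRat (-x) = cond s .zero .one :: l :: u := by
  have hb : x.num.natAbs.bits ≠ [] := by
    intro h0
    have : x.num.natAbs = 0 := bits_inj (by simpa using h0)
    exact hx (by simpa using this)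
  obtain ⟨y, l, hl⟩ := List.exists_cons_of_ne_nil hb
  refine ⟨decide (x < 0), cond y .one .zero, _, by cases y <;> simp,
    isItem_rat l x.den.bits, ?_, ?_⟩
  · rw [encodeRat, hl]
    by_cases h0 : x < 0 <;> simp [h0, encodeWord]
  · rw [encodeRat, Rat.num_neg_eq_neg_num, Rat.neg_den, Int.natAbs_neg, hl]
    rcases lt_or_gt_of_ne hx with h0 | h0
    · simp [h0, h0.le, encodeWord]
    · simp [h0, h0.le.not_gt, encodeWord]

/-- Change the signs of numbers according to a list. -/
def flipList : List Bool → List ℚ → List ℚ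
  | [], xs => xs
  | _ :: _, [] => []
  | s :: ss, x :: xs => (if s then -x else x) :: flipList ss xs

theorem ofFn_flipSigns (s : List Bool) {n : ℕ} (v : Fin n → ℚ) :
    List.ofFn (flipSigns s v) = flipList s (List.ofFn v) := by
  induction n generalizing s with
  | zero => cases s <;> simp [flipList]
  | succ n ih =>
    cases s with
    | nil => simp [flipList]
    | cons t s =>
      rw [List.ofFn_succ, List.ofFn_succ, flipList, ← ih]
      simp [flipSigns]
      rfl

end Words

section Row

/-- Write a `ReLU` node with the weights `x`, `y`, and `z` for every letter on the stack `c`. -/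
def writeRow (w : List Bool) (x y z : ℚ) : Prog Sym :=
  emit .out (nodeHead w ++ (entry x ++ entry y)) ⨾ spread .c .out .b (fun _ => entry z) id ⨾
    move .b .c (fun _ => false) id ⨾ .push .out .done

theorem exec_writeRow {F : Set (ℝ → ℝ)} (name : F ↪ List Bool) (h : ReLU ∈ F) {x y z : ℚ}
    (hx : (entry x).length ≤ 6) (hy : (entry y).length ≤ 6) (hz : (entry z).length ≤ 6)
    (n : ℕ) (i o a c g j : List Letter) (q : List (Option Letter)) (hc : c.length = n) :
    Exec (writeRow (name ⟨ReLU, h⟩) x y z) (st i o a [] c g j q)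
      (st i ((Letter.next :: encodeNeuron name
        (reluNeuron h (cons₂ x y fun _ : Fin n => z))).reverse ++ o) a [] c g j q)
      (11 * n + (name ⟨ReLU, h⟩).length + 25) := by
  refine ((exec_emit_out ..).seq ((exec_spread_c_out_b fun _ => hz).seq
    ((exec_move_b_c ..).seq (exec_push_out ..)))).congr ?_ ?_
  · have hf : (c.flatMap fun _ => entry z) = (List.replicate n z).flatMap entry := by
      rw [← hc]
      clear hc
      induction c with
      | nil => simp
      | cons x c ih => simp [ih, List.replicate_succ]
    rw [encodeNeuron_reluNeuron, encodeTuple_cons₂, encodeTuple_const, hf]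
    simp [entry]
  · simp [length_nodeHead, hc]
    omega

/-- Write the two nodes of a layer that pass on the additional inputs. -/
def writePass (w : List Bool) : Prog Sym := writeRow w 1 0 0 ⨾ writeRow w 0 1 0

theorem exec_writePass {F : Set (ℝ → ℝ)} (name : F ↪ List Bool) (h : ReLU ∈ F)
    (n : ℕ) (i o a c g j : List Letter) (q : List (Option Letter)) (hc : c.length = n) :
    Exec (writePass (name ⟨ReLU, h⟩)) (st i o a [] c g j q)
      (st i ((Letter.next :: (encodeNeuron name (reluNeuron h (cons₂ 1 0 (0 : Fin n → ℚ))) ++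
        Letter.next :: encodeNeuron name (reluNeuron h (cons₂ 0 1 (0 : Fin n → ℚ))))).reverse ++ o)
        a [] c g j q)
      (22 * n + 2 * (name ⟨ReLU, h⟩).length + 50) := by
  have h0 := length_entry_zero
  have h1 := length_entry_one
  refine ((exec_writeRow name h (by omega) (by omega) (by omega) n i o a c g j q hc).seq
    (exec_writeRow name h (by omega) (by omega) (by omega) n i _ a c g j q hc)).congr ?_ (by omega)
  have h2 : (fun _ : Fin n => (0 : ℚ)) = 0 := rfl
  rw [h2]
  simp

end Row

section Layers

/-- Copy a rational number from the input to the output and change its sign. -/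
def copyNeg : Prog Sym :=
  .case .inp fun
    | none => .skip
    | some s => .case .inp fun
      | none => .skip
      | some l =>
        if l = .slash then emit .out [.zero, .slash] ⨾ copyOut
        else emit .out [if s = .one then .zero else .one, l] ⨾ copyOut

theorem exec_copyNeg (x : ℚ) (i o a b c g j : List Letter) (q : List (Option Letter)) :
    Exec copyNeg (st (encodeRat x ++ i) o a b c g j q)
      (st i ((encodeRat (-x)).reverse ++ o) a b c g j q) (2 * (encodeRat x).length + 5) := by
  -- Zero must keep its sign letter. It is recognized by the `slash` directly after the sign, since
  -- its numerator has no binary digits.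
  rcases eq_or_ne x 0 with rfl | hx
  · rw [neg_zero, encodeRat_zero]
    have hu : IsItem [Letter.one, Letter.semi] := ⟨[.one], rfl, by simp⟩
    exact (exec_case_inp (exec_case_inp ((exec_emit_out _ _ _ _ _ _ _ _ [.zero, .slash]).seq
      (exec_copyOut hu)))).congr (by simp) (by simp)
  · obtain ⟨s, l, u, hl, hu, h1, h2⟩ := exists_encodeRat_eq hx
    rw [h1, h2]
    refine (exec_case_inp (exec_case_inp (n := 3 + 2 * u.length) ?_)).congr rfl
      (by simp; omega)
    simp only [hl, if_false]
    exact ((exec_emit_out ..).seq (exec_copyOut hu)).congr (by cases s <;> simp) (by simp)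

/-- Copy a weight from the input to the output, and change its sign if this is demanded by the
stack `g`, whose top letter is moved to the stack `b`. -/
def copyWeight : Prog Sym :=
  .push .out .next ⨾ .case .g fun
    | none => copyOut
    | some s => .push .b s ⨾ if s = .one then copyNeg else copyOut

/-- Signs and weights are consumed in parallel, hence a direct induction. Once `g` is empty, the
remaining weights are copied unchanged, which agrees with `flipSigns` beyond the end of its list.
The used signs are kept on `b` for the next node. -/
theorem exec_loop_copyWeight (ws : List ℚ) (s : List Bool) (i o a b c j : List Letter)
    (q : List (Option Letter)) :
    Exec (.loop .inp (stopAt .done) fun _ => copyWeight)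
      (st (encodeList encodeRat ws ++ i) o a b c (encodeWord s) j q)
      (st i (((flipList s ws).flatMap entry).reverse ++ o) a
        ((encodeWord (s.take ws.length)).reverse ++ b) c (encodeWord (s.drop ws.length)) j q)
      (9 * (encodeList encodeRat ws).length) := by
  rw [encodeList_append, length_encodeList]
  induction ws generalizing s o b with
  | nil =>
    refine (exec_exit_inp rfl).congr ?_ (by simp)
    cases s <;> simp [flipList, encodeWord]
  | cons w ws ih =>
    cases s with
    | nil =>
      have h := ih [] ((encodeRat w).reverse ++ Letter.next :: o) b
      refine Exec.congr' (s := st (.next :: (encodeRat w ++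
        ((ws.flatMap fun a => .next :: encodeRat a) ++ .done :: i))) o a b c [] j q) ?_ (by simp [encodeWord])
      refine (exec_iter_inp rfl ((exec_push_out ..).seq (exec_case_g_nil
        (n := 2 * (encodeRat w).length) ?_)) h).congr ?_ ?_
      · exact exec_copyOut (isItem_encodeRat w)
      · simp [flipList, entry, encodeWord]
      · simp only [List.flatMap_cons, List.length_append, List.length_cons]
        omega
    | cons t s =>
      have h : Exec (if (cond t Letter.one Letter.zero) = .one then copyNeg else copyOut)
          (st (encodeRat w ++ ((ws.flatMap fun a => Letter.next :: encodeRat a) ++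
            Letter.done :: i)) (Letter.next :: o) a (cond t Letter.one Letter.zero :: b) c
            (encodeWord s) j q)
          (st ((ws.flatMap fun a => Letter.next :: encodeRat a) ++ Letter.done :: i)
            ((encodeRat (if t then -w else w)).reverse ++ Letter.next :: o) a
            (cond t Letter.one Letter.zero :: b) c (encodeWord s) j q)
          (2 * (encodeRat w).length + 5) := by
        cases t
        · exact (exec_copyOut (isItem_encodeRat w)).mono (by omega)
        · exact exec_copyNeg ..
      refine Exec.congr' (s := st (.next :: (encodeRat w ++
        ((ws.flatMap fun a => .next :: encodeRat a) ++ .done :: i))) o a b c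
        (cond t .one .zero :: encodeWord s) j q) ?_ (by simp [encodeWord])
      refine (exec_iter_inp rfl ((exec_push_out ..).seq (exec_case_g
        ((exec_push_b ..).seq h))) (ih s _ _)).congr ?_ ?_
      · simp [flipList, entry, encodeWord]
      · simp only [List.flatMap_cons, List.length_append, List.length_cons]
        omega

/-- Copy a node without its separator from the input to the output, with changed signs of weights,
and with two additional weights, and count the node on the stack `c`. -/
def writeNeuron : Prog Sym :=
  .push .out .next ⨾ copyOut ⨾ copyOut ⨾ emit .out (entry 0 ++ entry 0) ⨾
    .loop .inp (stopAt .done) (fun _ => copyWeight) ⨾ .push .out .done ⨾ .push .c .zero ⨾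
    move .b .g (fun _ => false) id

theorem exec_writeNeuron {F : Set (ℝ → ℝ)} (name : F ↪ List Bool) {n : ℕ} (v : Neuron F n)
    (s : List Bool) (hs : s.length ≤ n) (i o a c j : List Letter) (q : List (Option Letter)) :
    Exec writeNeuron (st (encodeNeuron name v ++ i) o a [] c (encodeWord s) j q)
      (st i ((Letter.next :: encodeNeuron name (liftNeuron s v)).reverse ++ o) a [] (.zero :: c)
        (encodeWord s) j q)
      (34 * ((encodeNeuron name v).length + 1)) := by
  have hn := le_length_encodeTuple encodeRat v.weight
  have h0 := length_entry_zero
  have hl : (encodeWord s).length = s.length := by simp [encodeWord]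
  have hw := exec_loop_copyWeight (List.ofFn v.weight) s i
    ((entry 0 ++ entry 0).reverse ++ ((encodeRat v.bias).reverse ++
      ((encodeWord (name v.act) ++ [Letter.semi]).reverse ++ Letter.next :: o))) a [] c j q
  -- There are no more signs than weights, so all of them end up on `b`, and moving `b` back
  -- restores `g`.
  rw [List.take_of_length_le (by simpa using hs), List.drop_of_length_le (by simpa using hs)] at hw
  refine Exec.congr' (s := st ((encodeWord (name v.act) ++ [Letter.semi]) ++ (encodeRat v.bias ++
    (encodeTuple encodeRat v.weight ++ i))) o a [] c (encodeWord s) j q) ?_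
    (by simp [encodeNeuron])
  refine ((exec_push_out ..).seq ((exec_copyOut (isItem_encodeWord _)).seq
    ((exec_copyOut (isItem_encodeRat _)).seq ((exec_emit_out ..).seq (hw.seq ((exec_push_out ..).seq
    ((exec_push_c ..).seq (exec_move_b_g ..)))))))).congr ?_ ?_
  · have he : encodeNeuron name (liftNeuron s v) = encodeWord (name v.act) ++ Letter.semi ::
        (encodeRat v.bias ++ (entry 0 ++ (entry 0 ++
          ((flipList s (List.ofFn v.weight)).flatMap entry ++ [Letter.done])))) := by
      rw [encodeNeuron, liftNeuron, encodeTuple_cons₂, encodeTuple, ofFn_flipSigns,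
        encodeList_encodeRat]
      simp [entry]
    rw [he]
    simp [encodeWord]
  · simp only [encodeNeuron, List.length_append, List.length_cons, List.length_reverse,
      List.length_nil]
    rw [← encodeTuple]
    omega

/-- Write a layer of the lifted network. -/
def writeLayer (w : List Bool) : Prog Sym :=
  writePass w ⨾ clear Sym .c ⨾ .loop .inp (stopAt .done) (fun _ => writeNeuron) ⨾
    emit .out [.done, .next] ⨾ clear Sym .g

/-- At the start `c` shows the width of the previous layer, which the two passing nodes need;
afterwards it counts the nodes of the present layer. The signs are discarded at the end, as they
concern the first layer only. -/
theorem exec_writeLayer {F : Set (ℝ → ℝ)} (name : F ↪ List Bool) (h : ReLU ∈ F) {n m : ℕ}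
    (l : Layer F n m) (s : List Bool) (hs : s.length ≤ n) (i o a j : List Letter)
    (q : List (Option Letter)) :
    Exec (writeLayer (name ⟨ReLU, h⟩))
      (st (encodeTuple (encodeNeuron name) l ++ i) o a [] (List.replicate n Letter.zero)
        (encodeWord s) j q)
      (st i ((encodeTuple (encodeNeuron name) (passLayer h fun i => liftNeuron s (l i)) ++
        [Letter.next]).reverse ++ o) a [] (List.replicate m Letter.zero) [] j q)
      (26 * n + 2 * (name ⟨ReLU, h⟩).length + 60 +
        35 * (encodeTuple (encodeNeuron name) l).length) := by
  have hl : (encodeWord s).length = s.length := by simp [encodeWord]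
  rw [encodeTuple, encodeList_append, length_encodeList]
  refine ((exec_writePass name h n _ _ _ _ _ _ _ (by simp)).seq ((exec_clear_c ..).seq
    ((exec_loop_flatMap (Γ := Sym) (k := .inp) Letter.next Letter.done rfl rfl (encodeNeuron name)
      (fun d r => st r ((d.flatMap fun v => Letter.next ::
        encodeNeuron name (liftNeuron s v)).reverse ++ ((Letter.next :: (encodeNeuron name
          (reluNeuron h (cons₂ 1 0 (0 : Fin n → ℚ))) ++ Letter.next :: encodeNeuron name
          (reluNeuron h (cons₂ 0 1 (0 : Fin n → ℚ))))).reverse ++ o)) a []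
        (List.replicate d.length Letter.zero) (encodeWord s) j q) (fun _ _ => rfl)
      (fun _ _ _ => update_inp ..) 34 ?_ _ [] i).seq
    ((exec_emit_out ..).seq (exec_clear_g ..))))).congr ?_ ?_
  · intro d x r
    exact (exec_writeNeuron name x s hs ..).congr (by simp [List.replicate_succ]) le_rfl
  · have hd : (List.ofFn l).flatMap (fun v => Letter.next :: encodeNeuron name (liftNeuron s v)) =
        (List.ofFn fun i => liftNeuron s (l i)).flatMap
          fun v => Letter.next :: encodeNeuron name v := by
      rw [← Function.comp_def (liftNeuron s) l, ← List.map_ofFn, List.flatMap_map]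
    rw [passLayer, encodeTuple_cons₂, encodeTuple, encodeList, ← hd]
    simp
  · simp
    omega

/-- The encoding of the layers of a lifted network, each one followed by the letter `next`. -/
noncomputable def encodeLift {F : Set (ℝ → ℝ)} (name : F ↪ List Bool) (h : ReLU ∈ F) :
    {n m : ℕ} → List Bool → Network F n m → List Letter
  | _, _, s, .output l =>
      encodeTuple (encodeNeuron name) (passLayer h fun i => liftNeuron s (l i)) ++ [.next]
  | _, _, s, .hidden l N =>
      encodeTuple (encodeNeuron name) (passLayer h fun i => liftNeuron s (l i)) ++ [.next] ++
        encodeLift name h [] N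

theorem encodeNetwork_liftNetwork {F : Set (ℝ → ℝ)} (name : F ↪ List Bool) (h : ReLU ∈ F)
    {n m m' : ℕ} (s : List Bool) (N : Network F n m) (T : Network F (m + 2) m') :
    encodeNetwork name (liftNetwork h s N T) = encodeLift name h s N ++ encodeNetwork name T := by
  induction N generalizing s with
  | output l => simp [liftNetwork, encodeNetwork, encodeLift]
  | hidden l N ih => simp [liftNetwork, encodeNetwork, encodeLift, ih]

/-- The term `26 * n` pays for the incoming width of the first layer; the width of each further
layer is charged to the encoding of its predecessor. -/
theorem exec_loop_writeLayer {F : Set (ℝ → ℝ)} (name : F ↪ List Bool) (h : ReLU ∈ F) {n m : ℕ}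
    (N : Network F n m) (s : List Bool) (hs : s.length ≤ n) (i o a j : List Letter)
    (q : List (Option Letter)) :
    Exec (.loop .inp (stopAt .done) fun _ => writeLayer (name ⟨ReLU, h⟩))
      (st (Letter.next :: (encodeNetwork name N ++ i)) o a [] (List.replicate n Letter.zero)
        (encodeWord s) j q)
      (st i ((encodeLift name h s N).reverse ++ o) a [] (List.replicate m Letter.zero) [] j q)
      ((2 * (name ⟨ReLU, h⟩).length + 70) * (encodeNetwork name N).length + 26 * n) := by
  induction N generalizing s o with
  | output l =>
    have hl := exec_writeLayer name h l s hs (Letter.done :: i) o a j q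
    refine (exec_iter_inp rfl (hl.congr' ?_) (exec_exit_inp rfl)).congr rfl ?_
    · simp [encodeNetwork]
    · simp only [encodeNetwork, List.length_append, List.length_cons, List.length_nil]
      nlinarith
  | @hidden n k m l N ih =>
    have hl := exec_writeLayer name h l s hs (Letter.next :: (encodeNetwork name N ++ i)) o a j q
    have ih := ih [] (by simp) ((encodeTuple (encodeNeuron name)
      (passLayer h fun i => liftNeuron s (l i)) ++ [Letter.next]).reverse ++ o)
    refine (exec_iter_inp rfl (hl.congr' ?_) ih).congr ?_ ?_
    · simp [encodeNetwork]
    · simp [encodeLift]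
    · have hk := le_length_encodeTuple (encodeNeuron name) l
      simp only [encodeNetwork, List.length_append, List.length_cons]
      nlinarith

end Layers

end NeuralNet

/-! ### Writing the comparison network -/

namespace NeuralNet

open StackProgram

section Compare

/-- The weight `-1` for the letter `one`, and `0` for all others. -/
def letterWeight (x : Letter) : ℚ := if x = .one then -1 else 0

/-- The weight `0` for the letter `one`, and `1` for all others. -/
def pivotWeight (x : Letter) : ℚ := if x = .one then 0 else 1

/-- Turn the `m` letters on the stack `c` into the letter `one` at the place given by the stack `j`,
and the letter `zero` at all other places. -/
def markIndex : Prog Sym :=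
  .loop .j (fun _ => false) (fun _ => .case .c fun _ => .push .b .zero) ⨾
    .case .c (fun _ => .push .c .one) ⨾ move .b .c (fun _ => false) id

theorem exec_markIndex (k r : ℕ) (i o a g : List Letter) (q : List (Option Letter)) :
    Exec markIndex
      (st i o a [] (List.replicate (k + 1 + r) Letter.zero) g (List.replicate k Letter.one) q)
      (st i o a [] (List.replicate k Letter.zero ++ Letter.one :: List.replicate r Letter.zero)
        g [] q) (6 * k + 6) := by
  have hloop : ∀ b : List Letter, Exec (.loop .j (fun _ => false)
        (fun _ => .case .c fun _ => .push .b .zero) : Prog Sym)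
      (st i o a b (List.replicate (k + 1 + r) Letter.zero) g (List.replicate k Letter.one) q)
      (st i o a (List.replicate k Letter.zero ++ b) (List.replicate (1 + r) Letter.zero) g [] q)
      (3 * k + 1) := by
    induction k with
    | zero => exact fun b => (Exec.exit (by simp)).congr (by simp) (by simp)
    | succ k ih =>
      intro b
      refine (Exec.iter (a := Letter.one) rfl rfl (m := 2)
        (t := st i o a (.zero :: b) (List.replicate (k + 1 + r) Letter.zero) g
          (List.replicate k Letter.one) q) ?_ (ih _)).congr ?_ (by omega)
      · have : k + 1 + 1 + r = (k + 1 + r) + 1 := by omega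
        rw [this]
        simp only [List.replicate_succ, st_j, List.tail_cons, update_j]
        exact exec_case_c (exec_push_b ..)
      · simp [List.replicate_succ', List.append_assoc]
  have h1 : List.replicate (1 + r) Letter.zero = .zero :: List.replicate r .zero := by
    rw [Nat.add_comm, List.replicate_succ]
  have h := hloop []
  rw [h1] at h
  refine (h.seq ((exec_case_c (exec_push_c ..)).seq (exec_move_b_c ..))).congr (by simp) ?_
  simp
  omega

/-- The weights of a comparison node, whose pivot is the letter `x` between the words `u` and
`v`. -/
def compareWeights (u : List Letter) (x : Letter) (v : List Letter) : List ℚ :=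
  u.map letterWeight ++ pivotWeight x :: v.map letterWeight

/-- The weights of all comparison nodes with a pivot in the word `v`, which follows `u`. -/
def compareRows (u : List Letter) : List Letter → List (List ℚ)
  | [] => []
  | x :: v => compareWeights u x v :: compareRows (u ++ [x]) v

/-- Write the comparison nodes for the word on the stack `c`. -/
def writeCompare (w : List Bool) : Prog Sym :=
  .loop .c (fun _ => false) fun x =>
    emit .out (nodeHead w ++ (entry 0 ++ entry 0)) ⨾ move .a .b (fun _ => false) id ⨾
      spread .b .out .a (fun x => entry (letterWeight x)) id ⨾
      emit .out (entry (pivotWeight x)) ⨾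
      spread .c .out .b (fun x => entry (letterWeight x)) id ⨾ move .b .c (fun _ => false) id ⨾
      .push .out .done ⨾ .push .a x

theorem length_entry_letterWeight (x : Letter) : (entry (letterWeight x)).length ≤ 6 := by
  have h0 := length_entry_zero
  have h1 := length_entry_neg_one
  unfold letterWeight
  split_ifs <;> omega

theorem length_entry_pivotWeight (x : Letter) : (entry (pivotWeight x)).length ≤ 6 := by
  have h0 := length_entry_zero
  have h1 := length_entry_one
  unfold pivotWeight
  split_ifs <;> omega

/-- The marked word is traversed with a cursor: `a` holds the part before the pivot in reverse
order, `c` the part after it. Every row scans both parts and restores them, which makes the time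
quadratic in the number of outputs. -/
theorem exec_writeCompare (w : List Bool) (u v : List Letter) (i o g j : List Letter)
    (q : List (Option Letter)) :
    Exec (writeCompare w) (st i o u.reverse [] v g j q)
      (st i (((compareRows u v).flatMap fun r => nodeHead w ++
        encodeList encodeRat (0 :: 0 :: r)).reverse ++ o) (u ++ v).reverse [] [] g j q)
      ((11 * (u.length + v.length) + w.length + 40) * v.length + 1) := by
  induction v generalizing u o with
  | nil => exact exec_exit_c.congr (by simp [compareRows]) (by simp)
  | cons x v ih =>
    have h1 := exec_move_a_b i (((nodeHead w ++ (entry 0 ++ entry 0))).reverse ++ o) u.reverse [] v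
      g j q
    rw [List.append_nil, List.reverse_reverse] at h1
    have h2 := ih (u ++ [x]) ((nodeHead w ++
      encodeList encodeRat (0 :: 0 :: compareWeights u x v)).reverse ++ o)
    have hp := length_entry_pivotWeight x
    have h0 := length_entry_zero
    have hh := length_nodeHead w
    refine (exec_iter_c rfl (((exec_emit_out ..).seq (h1.seq ((exec_spread_b_out_a
      length_entry_letterWeight).seq ((exec_emit_out ..).seq ((exec_spread_c_out_b
      length_entry_letterWeight).seq ((exec_move_b_c ..).seq ((exec_push_out ..).seq
      (exec_push_a ..)))))))).congr ?_ le_rfl) h2).congr ?_ ?_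
    · rw [encodeList_encodeRat]
      simp [compareWeights, List.flatMap_map]
    · simp [compareRows]
    · simp only [List.length_append, List.length_cons, List.length_nil, List.length_reverse]
      have hm : (11 * (u.length + (v.length + 1)) + w.length + 40) * (v.length + 1) =
          (11 * (u.length + (v.length + 1)) + w.length + 40) * v.length +
          (11 * (u.length + (v.length + 1)) + w.length + 40) := by ring
      have ha : u.length + (0 + 1) + v.length = u.length + (v.length + 1) := by omega
      rw [hm, ha]
      omega

variable {F : Set (ℝ → ℝ)} (name : F ↪ List Bool) (h : ReLU ∈ F)

/-- Describes the rows by positions instead of by the cursor: row `k` has its pivot at place `k`,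
and every other place only sees its own letter. -/
theorem compareRows_eq_map (u v : List Letter) :
    compareRows u v = (List.range' u.length v.length).map fun k =>
      (u ++ v).mapIdx fun l x => if l = k then pivotWeight x else letterWeight x := by
  induction v generalizing u with
  | nil => simp [compareRows]
  | cons x v ih =>
    rw [compareRows, ih, List.length_cons, List.range'_succ, List.map_cons]
    congr 1
    · refine List.ext_getElem (by simp [compareWeights]) fun n h1 h2 => ?_
      rw [List.getElem_mapIdx]
      simp only [compareWeights, List.getElem_append, List.length_map]
      split_ifs with h3 h4 h4
      · omega
      · simp
      · simp [h4]
      · obtain ⟨n', rfl⟩ : ∃ n', n = u.length + (n' + 1) := ⟨n - u.length - 1, by omega⟩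
        simp
    · simp

/-- Only the place `j` carries the letter `one`. Hence `letterWeight` gives `-1` exactly there, and
`pivotWeight` gives `1` unless the pivot is `j` itself, where the two contributions cancel. -/
theorem ofFn_diffNeuron_weight {m : ℕ} (j : Fin m) :
    (List.ofFn fun i => List.ofFn fun l =>
      if l = i then (if l = j then (0 : ℚ) else 1) else if l = j then -1 else 0) =
    compareRows [] (List.replicate j Letter.zero ++ Letter.one ::
      List.replicate (m - 1 - j) Letter.zero) := by
  have hlen : (List.replicate j Letter.zero ++ Letter.one ::
      List.replicate (m - 1 - j) Letter.zero).length = m := by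
    simp
    omega
  have hget : ∀ l : ℕ, ∀ hl : l < (List.replicate j Letter.zero ++ Letter.one ::
      List.replicate (m - 1 - j) Letter.zero).length, (List.replicate j Letter.zero ++ Letter.one ::
      List.replicate (m - 1 - j) Letter.zero)[l] = if l = j then Letter.one else Letter.zero := by
    intro l hl
    rcases lt_trichotomy l j with h1 | h1 | h1
    · rw [List.getElem_append_left (by simpa using h1)]
      simp [h1.ne]
    · subst h1
      simp
    · obtain ⟨n, hn⟩ : ∃ n, l = j + (n + 1) := ⟨l - j - 1, by omega⟩
      subst hn
      simp [List.getElem_append_right]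
  rw [compareRows_eq_map]
  refine List.ext_getElem (by simp [hlen]) fun i h1 h2 => ?_
  rw [List.getElem_ofFn, List.getElem_map]
  refine List.ext_getElem (by simp [hlen]) fun l h3 h4 => ?_
  rw [List.getElem_ofFn, List.getElem_mapIdx]
  simp only [List.nil_append, hget, List.length_nil, List.getElem_range', Nat.zero_add, Nat.one_mul,
    Fin.ext_iff, letterWeight, pivotWeight]
  by_cases h5 : l = j <;> by_cases h6 : l = i <;> simp [h5, h6]

theorem encodeTuple_diffNeuron {m : ℕ} (j : Fin m) :
    encodeTuple (encodeNeuron name) (diffNeuron h j) =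
      ((compareRows [] (List.replicate j Letter.zero ++ Letter.one ::
        List.replicate (m - 1 - j) Letter.zero)).flatMap fun r =>
          nodeHead (name ⟨ReLU, h⟩) ++ encodeList encodeRat (0 :: 0 :: r)) ++ [Letter.done] := by
  rw [← ofFn_diffNeuron_weight, encodeTuple, encodeList]
  congr 1
  have h1 : List.ofFn (diffNeuron h j) = (List.finRange m).map (diffNeuron h j) :=
    List.ofFn_eq_map
  rw [h1, List.ofFn_eq_map, List.flatMap_map, List.flatMap_map]
  refine List.flatMap_congr fun i _ => ?_
  rw [diffNeuron, encodeNeuron_reluNeuron, encodeTuple_cons₂]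
  simp [encodeList, encodeTuple]

/-- Write the network that compares the outputs. -/
def writeTail (w : List Bool) : Prog Sym :=
  markIndex ⨾ writePass w ⨾ writeCompare w ⨾ move .a .c (fun _ => false) id ⨾
    emit .out [.done, .next] ⨾ writeRow w 1 (-1) 1 ⨾ writeRow w (-1) 1 1 ⨾ writeRow w 1 1 0 ⨾
    emit .out [.done, .done] ⨾ clear Sym .c

theorem exec_writeTail {m : ℕ} (j : Fin m) (o : List Letter) :
    Exec (writeTail (name ⟨ReLU, h⟩))
      (st [] o [] [] (List.replicate m Letter.zero) [] (List.replicate j Letter.one) [])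
      (st [] ((encodeNetwork name (compareNetwork h j)).reverse ++ o) [] [] [] [] [] [])
      ((11 * m + (name ⟨ReLU, h⟩).length + 40) * m + 70 * m + 5 * (name ⟨ReLU, h⟩).length +
        160) := by
  have h0 := length_entry_zero
  have h1 := length_entry_one
  have h2 := length_entry_neg_one
  obtain ⟨P, hP⟩ : ∃ P, P = List.replicate j Letter.zero ++ Letter.one ::
    List.replicate (m - 1 - j) Letter.zero := ⟨_, rfl⟩
  have hlen : P.length = m := by
    rw [hP]
    simp
    omega
  have hmark := exec_markIndex j (m - 1 - j) [] o [] [] []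
  rw [← hP, show (j : ℕ) + 1 + (m - 1 - j) = m by omega] at hmark
  have hcomp := exec_writeCompare (name ⟨ReLU, h⟩) [] P [] ((Letter.next :: (encodeNeuron name
    (reluNeuron h (cons₂ 1 0 (0 : Fin m → ℚ))) ++ Letter.next :: encodeNeuron name
    (reluNeuron h (cons₂ 0 1 (0 : Fin m → ℚ))))).reverse ++ o) [] [] []
  -- The traversal has emptied `c`. The word is fetched back from `a`, because its length `m` is the
  -- number of weights that the output nodes need for `z`.
  have hmove : ∀ o, Exec (move .a .c (fun _ => false) id : Prog Sym)
      (st [] o ([] ++ P).reverse [] [] [] [] []) (st [] o [] [] P [] [] []) (2 * m + 1) := by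
    intro o
    exact (exec_move_a_c ..).congr (by simp) (by simp [hlen])
  refine (hmark.seq ((exec_writePass name h m _ _ _ _ _ _ _ hlen).seq (hcomp.seq ((hmove _).seq
    ((exec_emit_out ..).seq ((exec_writeRow name h (by omega) (by omega) (by omega) m _ _ _ _ _ _ _
    hlen).seq ((exec_writeRow name h (by omega) (by omega) (by omega) m _ _ _ _ _ _ _
    hlen).seq ((exec_writeRow name h (by omega) (by omega) (by omega) m _ _ _ _ _ _ _
    hlen).seq ((exec_emit_out ..).seq (exec_clear_c ..)))))))))).congr ?_ ?_
  · have hT : encodeTuple (encodeNeuron name) ![reluNeuron h (cons₂ 1 (-1) (1 : Fin m → ℚ)),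
        reluNeuron h (cons₂ (-1) 1 (1 : Fin m → ℚ)), reluNeuron h (cons₂ 1 1 (0 : Fin m → ℚ))] =
        Letter.next :: (encodeNeuron name (reluNeuron h (cons₂ 1 (-1) (1 : Fin m → ℚ))) ++
        Letter.next :: (encodeNeuron name (reluNeuron h (cons₂ (-1) 1 (1 : Fin m → ℚ))) ++
        Letter.next :: (encodeNeuron name (reluNeuron h (cons₂ 1 1 (0 : Fin m → ℚ))) ++
          [Letter.done]))) := by
      simp [encodeTuple, encodeList]
    rw [compareNetwork, encodeNetwork, encodeNetwork, hT, passLayer, encodeTuple_cons₂,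
      encodeTuple_diffNeuron, ← hP]
    have e1 : (fun _ : Fin m => (1 : ℚ)) = 1 := rfl
    have e0 : (fun _ : Fin m => (0 : ℚ)) = 0 := rfl
    rw [e1, e0]
    simp
  · simp only [hlen, List.length_nil, List.length_cons, Nat.zero_add]
    have := j.isLt
    omega

end Compare

end NeuralNet

/-! ### Writing the center, the radius, and the constant layer -/

namespace NeuralNet

open StackProgram

section Head

/-- Write the center for a positive radius, extended by two zeros. -/
def writeCenter : Prog Sym :=
  emit .out (entry 0 ++ entry 0) ⨾ move .a .b (fun _ => false) id ⨾
    move .b .out (fun _ => false) id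

/-- Write the node with a constant output for an entry of the center on the stack `b`, and push its
sign onto the stack `a`. -/
def writeConst (w : List Bool) : Prog Sym :=
  emit .out (.next :: (encodeWord w ++ [.semi])) ⨾
    .case .b (fun
      | some s => .push .a s
      | none => .skip) ⨾
    .push .out .zero ⨾ copyB ⨾ emit .out (encodeList encodeRat [0, 0])

/-- Write the center, the radius and the first layer for radius zero, and the signs of the center
to the stack `g`. -/
def writeConstLayer (w : List Bool) : Prog Sym :=
  emit .out (encodeList encodeRat [0, 0] ++ (encodeRat 1 ++
      ((nodeHead w ++ encodeList encodeRat [1, 0]) ++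
        (nodeHead w ++ encodeList encodeRat [0, 1])))) ⨾
    move .a .b (fun _ => false) id ⨾ .loop .b (stopAt .done) (fun _ => writeConst w) ⨾
    emit .out [.done, .next] ⨾ move .a .g (fun _ => false) id

/-- Read the radius, and write everything that precedes the lifted network. -/
def writeHead (w : List Bool) : Prog Sym :=
  .case .inp fun
    | none => .skip
    | some .infty => writeCenter ⨾ .push .out .infty
    | some s => .case .inp fun
      | none => .skip
      | some .slash => .case .inp fun _ => .case .inp fun _ => writeConstLayer w
      | some l => writeCenter ⨾ emit .out [s, l] ⨾ copyOut

variable {i o a b c g j : List Letter} {q : List (Option Letter)}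

theorem exec_writeCenter {n : ℕ} (v : Fin n → ℚ) :
    Exec writeCenter (st i o (encodeTuple encodeRat v).reverse [] c g j q)
      (st i ((encodeTuple encodeRat (cons₂ 0 0 v)).reverse ++ o) [] [] c g j q)
      (4 * (encodeTuple encodeRat v).length + 13) := by
  have h0 := length_entry_zero
  refine ((exec_emit_out ..).seq ((exec_move_a_b ..).seq (exec_move_b_out ..))).congr ?_ ?_
  · rw [encodeTuple_cons₂]
    simp [entry]
  · simp
    omega

theorem encodeTuple_zero_two : encodeTuple encodeRat (cons₂ 0 0 (0 : Fin 0 → ℚ)) =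
    encodeList encodeRat [0, 0] := by
  simp [encodeTuple, cons₂]

theorem encodeRadius_coe (e : ℚ≥0) : encodeRadius (e : WithTop ℚ≥0) = encodeRat (e : ℚ) := rfl

theorem encodeRadius_zero : encodeRadius 0 = encodeRat 0 := encodeRadius_coe 0

theorem encodeRadius_one : encodeRadius 1 = encodeRat 1 := encodeRadius_coe 1

theorem exec_writeConst {F : Set (ℝ → ℝ)} (name : F ↪ List Bool) (h : ReLU ∈ F) (x : ℚ) :
    Exec (writeConst (name ⟨ReLU, h⟩)) (st i o a (encodeRat x ++ b) c g j q)
      (st i ((Letter.next :: encodeNeuron name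
        ⟨⟨ReLU, h⟩, cons₂ 0 0 (0 : Fin 0 → ℚ), |x|⟩).reverse ++ o)
        (cond (decide (x < 0)) Letter.one Letter.zero :: a) b c g j q)
      (((name ⟨ReLU, h⟩).length + 20) * ((encodeRat x).length + 1)) := by
  -- The encodings of `x` and `|x|` differ at most in the sign letter, which is also the letter to
  -- be stored as a sign.
  obtain ⟨u, hu, h1, h2⟩ : ∃ u, IsItem u ∧
      encodeRat x = cond (decide (x < 0)) Letter.one Letter.zero :: u ∧
      encodeRat |x| = .zero :: u := by
    refine ⟨_, isItem_rat x.num.natAbs.bits x.den.bits, ?_, ?_⟩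
    · by_cases hx : x < 0 <;> simp [encodeRat, hx]
    · rw [encodeRat, Rat.num_abs_eq_abs_num, Rat.den_abs_eq_den, Int.natAbs_abs]
      simp
  have h5 := length_entry_zero
  have h6 : (encodeList encodeRat [0, 0]).length = 11 := by
    simp only [entry, List.length_cons] at h5
    simp [encodeList]
    omega
  rw [h1]
  refine ((exec_emit_out ..).seq ((exec_case_b (exec_push_a ..)).seq ((exec_push_out ..).seq
    ((exec_copyB hu).seq (exec_emit_out ..))))).congr ?_ ?_
  · rw [encodeNeuron, encodeTuple_zero_two, h2]
    simp
  · simp only [List.length_cons, List.length_append, List.length_nil, encodeWord, List.length_map,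
      h6]
    nlinarith

theorem exec_writeConstLayer {F : Set (ℝ → ℝ)} (name : F ↪ List Bool) (h : ReLU ∈ F) {n : ℕ}
    (v : Fin n → ℚ) :
    Exec (writeConstLayer (name ⟨ReLU, h⟩))
      (st i o (encodeTuple encodeRat v).reverse [] c [] j q)
      (st i ((encodeTuple encodeRat (cons₂ 0 0 (0 : Fin 0 → ℚ)) ++ (encodeRadius 1 ++
        (encodeTuple (encodeNeuron name) (constLayer h v) ++ [Letter.next]))).reverse ++ o)
        [] [] c (encodeWord (signs v)) j q)
      (((name ⟨ReLU, h⟩).length + 25) * (encodeTuple encodeRat v).length +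
        2 * (name ⟨ReLU, h⟩).length + 80) := by
  have hn := le_length_encodeTuple encodeRat v
  obtain ⟨o', ho'⟩ : ∃ o', o' = (encodeList encodeRat [0, 0] ++ (encodeRat 1 ++
      ((nodeHead (name ⟨ReLU, h⟩) ++ encodeList encodeRat [1, 0]) ++
        (nodeHead (name ⟨ReLU, h⟩) ++ encodeList encodeRat [0, 1])))).reverse ++ o := ⟨_, rfl⟩
  have h1 := exec_move_a_b i o' (encodeTuple encodeRat v).reverse [] c [] j q
  rw [List.append_nil, List.reverse_reverse] at h1
  have h2 := exec_loop_flatMap (Γ := Sym) (k := .b) (e := stopAt .done)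
      (body := fun _ => writeConst (name ⟨ReLU, h⟩)) Letter.next Letter.done rfl rfl encodeRat
      (fun d r => st i ((d.flatMap fun x => Letter.next :: encodeNeuron name
        ⟨⟨ReLU, h⟩, cons₂ 0 0 (0 : Fin 0 → ℚ), |x|⟩).reverse ++ o')
        (encodeWord (d.map fun x => decide (x < 0))).reverse r c [] j q) (fun _ _ => rfl)
      (fun _ _ _ => update_b ..) _ (fun d x r => (exec_writeConst name h x).congr
        (by simp [encodeWord]) le_rfl) (List.ofFn v) [] []
  have h3 := (exec_emit_out i o (encodeTuple encodeRat v).reverse [] c [] j q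
    (encodeList encodeRat [0, 0] ++ (encodeRat 1 ++
      ((nodeHead (name ⟨ReLU, h⟩) ++ encodeList encodeRat [1, 0]) ++
        (nodeHead (name ⟨ReLU, h⟩) ++ encodeList encodeRat [0, 1]))))).congr
    (congrArg (fun o => st i o _ _ _ _ _ _) ho'.symm) le_rfl
  have h4 := h2.congr' (s' := st i o' [] (encodeTuple encodeRat v) c [] j q)
    (by simp [encodeTuple, encodeList, encodeWord])
  rw [← length_encodeList, ← encodeTuple] at h4
  refine (h3.seq (h1.seq (h4.seq ((exec_emit_out ..).seq (exec_move_a_g ..))))).congr ?_ ?_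
  · have e3 : encodeTuple (encodeNeuron name) (fun i =>
        (⟨⟨ReLU, h⟩, cons₂ 0 0 (0 : Fin 0 → ℚ), |v i|⟩ : Neuron F (0 + 2))) =
        ((List.ofFn v).flatMap fun x => Letter.next :: encodeNeuron name
          ⟨⟨ReLU, h⟩, cons₂ 0 0 (0 : Fin 0 → ℚ), |x|⟩) ++ [Letter.done] := by
      rw [encodeTuple, encodeList, ← List.flatMap_map (f := fun x : ℚ =>
        (⟨⟨ReLU, h⟩, cons₂ 0 0 (0 : Fin 0 → ℚ), |x|⟩ : Neuron F (0 + 2)))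
        (g := fun v => Letter.next :: encodeNeuron name v), List.map_ofFn]
      rfl
    have e4 : encodeTuple encodeRat (cons₂ 1 0 (0 : Fin 0 → ℚ)) = encodeList encodeRat [1, 0] := by
      simp [encodeTuple, cons₂]
    have e5 : encodeTuple encodeRat (cons₂ 0 1 (0 : Fin 0 → ℚ)) = encodeList encodeRat [0, 1] := by
      simp [encodeTuple, cons₂]
    have e6 : signs v = (List.ofFn v).map fun x => decide (x < 0) := by
      rw [List.map_ofFn]
      rfl
    have e7 : encodeTuple (encodeNeuron name) (constLayer h v) =
        (nodeHead (name ⟨ReLU, h⟩) ++ encodeList encodeRat [1, 0]) ++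
        ((nodeHead (name ⟨ReLU, h⟩) ++ encodeList encodeRat [0, 1]) ++
        encodeTuple (encodeNeuron name) (fun i =>
        (⟨⟨ReLU, h⟩, cons₂ 0 0 (0 : Fin 0 → ℚ), |v i|⟩ : Neuron F (0 + 2)))) := by
      rw [constLayer, passLayer, encodeTuple_cons₂, ← e4, ← e5, ← encodeNeuron_reluNeuron,
        ← encodeNeuron_reluNeuron]
      simp
    rw [encodeTuple_zero_two, encodeRadius_one, e7, e3, e6, ho']
    simp
  · have h5 := length_entry_zero
    have h6 := length_entry_one
    simp only [entry, List.length_cons] at h5 h6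
    simp [encodeList, length_nodeHead, encodeWord]
    nlinarith

/-- Two letters decide the case: `infty` alone, a sign followed by `slash` for radius zero, and a
sign followed by a digit for a positive finite radius. -/
theorem exec_writeHead {F : Set (ℝ → ℝ)} (name : F ↪ List Bool) (h : ReLU ∈ F) {n : ℕ}
    (v : Fin n → ℚ) {e : WithTop ℚ≥0} (he : e ≠ 0) :
    Exec (writeHead (name ⟨ReLU, h⟩))
      (st (encodeRadius e ++ i) o (encodeTuple encodeRat v).reverse [] c g j q)
      (st i ((encodeTuple encodeRat (cons₂ 0 0 v) ++ encodeRadius e).reverse ++ o)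
        [] [] c g j q)
      (4 * (encodeTuple encodeRat v).length + 2 * (encodeRadius e).length + 20) := by
  cases e using WithTop.recTopCoe with
  | top =>
    exact (exec_case_inp ((exec_writeCenter v).seq (exec_push_out ..))).congr
      (by simp [encodeRadius]) (by simp [encodeRadius])
  | coe e =>
    have he' : (e : ℚ) ≠ 0 := by
      intro h0
      exact he (by simpa using h0)
    obtain ⟨s, l, u, hl, hu, h1, -⟩ := exists_encodeRat_eq he'
    have h2 : Exec (writeCenter ⨾ emit .out [cond s .one .zero, l] ⨾ copyOut)
        (st (u ++ i) o (encodeTuple encodeRat v).reverse [] c g j q)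
        (st i ((encodeTuple encodeRat (cons₂ 0 0 v) ++ cond s .one .zero :: l :: u).reverse ++ o)
        [] [] c g j q) (4 * (encodeTuple encodeRat v).length + 2 * u.length + 16) :=
      ((exec_writeCenter v).seq ((exec_emit_out ..).seq (exec_copyOut hu))).congr (by simp)
        (by simp; omega)
    rw [encodeRadius_coe, h1]
    have h3 : Exec (.case .inp fun
        | none => .skip
        | some .slash => .case .inp fun _ => .case .inp fun _ => writeConstLayer (name ⟨ReLU, h⟩)
        | some l => writeCenter ⨾ emit .out [cond s .one .zero, l] ⨾ copyOut : Prog Sym)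
        (st (l :: (u ++ i)) o (encodeTuple encodeRat v).reverse [] c g j q)
        (st i ((encodeTuple encodeRat (cons₂ 0 0 v) ++ cond s .one .zero :: l :: u).reverse ++ o)
        [] [] c g j q) (4 * (encodeTuple encodeRat v).length + 2 * u.length + 16 + 1) := by
      refine exec_case_inp ?_
      cases l <;> first | exact h2 | exact absurd rfl hl
    refine (exec_case_inp
      (n := 4 * (encodeTuple encodeRat v).length + 2 * u.length + 16 + 1) ?_).mono (by simp; omega)
    cases s <;> exact h3

/-- The four letters of the radius zero are popped one by one and discarded; this accounts for the
four steps on top of `exec_writeConstLayer`. -/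
theorem exec_writeHead_zero {F : Set (ℝ → ℝ)} (name : F ↪ List Bool) (h : ReLU ∈ F) {n : ℕ}
    (v : Fin n → ℚ) :
    Exec (writeHead (name ⟨ReLU, h⟩))
      (st (encodeRadius 0 ++ i) o (encodeTuple encodeRat v).reverse [] c [] j q)
      (st i ((encodeTuple encodeRat (cons₂ 0 0 (0 : Fin 0 → ℚ)) ++ (encodeRadius 1 ++
        (encodeTuple (encodeNeuron name) (constLayer h v) ++ [Letter.next]))).reverse ++ o)
        [] [] c (encodeWord (signs v)) j q)
      (((name ⟨ReLU, h⟩).length + 25) * (encodeTuple encodeRat v).length +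
        2 * (name ⟨ReLU, h⟩).length + 84) := by
  rw [encodeRadius_zero, encodeRat_zero]
  exact exec_case_inp (exec_case_inp (exec_case_inp (exec_case_inp
    (exec_writeConstLayer name h v))))

end Head

/-! ### The complete reduction of part ii) and its running time -/

section Main

variable {F : Set (ℝ → ℝ)} (name : F ↪ List Bool) (h : ReLU ∈ F)

/-- The program for the reduction from `CR` to `aCR`; `w` is the name of `ReLU`. -/
def reduce (w : List Bool) : Prog Sym :=
  move .inp .j (stopAt .semi) id ⨾ readCenter ⨾ writeHead w ⨾ .push .inp .next ⨾
    .loop .inp (stopAt .done) (fun _ => writeLayer w) ⨾ writeTail w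

theorem exec_readIndex (k : ℕ) (i : List Letter) :
    Exec (move .inp .j (stopAt .semi) id : Prog Sym)
      (st (List.replicate k .one ++ .semi :: i) [] [] [] [] [] [] [])
      (st i [] [] [] [] [] (List.replicate k .one) []) (2 * k + 1) := by
  refine (exec_move (by decide) (List.replicate k .one) (.semi :: i) _ rfl ?_
    (by simp [stopAt])).congr (by simp) (by simp)
  intro x hx
  rw [List.eq_of_mem_replicate hx]
  rfl

theorem exec_reduce (I : ClassInstance F) :
    Exec (reduce (name ⟨ReLU, h⟩))
      (st (I.encode name) [] [] [] [] [] [] [])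
      (st [] ((toArb h I).encode name).reverse [] [] [] [] [] [])
      (11 * (I.encode name).length ^ 2 +
        (4 * (name ⟨ReLU, h⟩).length + 250) * (I.encode name).length +
        7 * (name ⟨ReLU, h⟩).length + 250) := by
  obtain ⟨⟨n, m, N, e, v⟩, j⟩ := I
  obtain ⟨w, hw⟩ : ∃ w, w = name ⟨ReLU, h⟩ := ⟨_, rfl⟩
  have hn := le_length_encodeTuple encodeRat v
  have hm := le_length_encodeNetwork name N
  have hj : (j : ℕ) < m := j.isLt
  have hL : (ClassInstance.encode name ⟨⟨n, m, N, e, v⟩, j⟩).length = j + 1 +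
      (encodeTuple encodeRat v).length + (encodeRadius e).length +
      (encodeNetwork name N).length := by
    simp [ClassInstance.encode, ArbInstance.encode]
    omega
  have h1 := exec_readIndex j (encodeTuple encodeRat v ++ (encodeRadius e ++
    (encodeNetwork name N)))
  have h2 := exec_readCenter (List.ofFn v) (encodeRadius e ++ (encodeNetwork name N)) [] [] [] []
    [] (List.replicate j Letter.one) []
  rw [← encodeTuple, List.append_nil, List.append_nil, List.length_ofFn] at h2
  -- Both cases of the radius continue with the same program: only the output so far and the sign
  -- list differ. The counter `n` is right in both, because the constant layer feeds `n` values to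
  -- the network, as many as its original inputs.
  obtain ⟨pre, s, hs, h3, henc⟩ : ∃ (pre : List Letter) (s : List Bool), s.length ≤ n ∧
      Exec (writeHead (name ⟨ReLU, h⟩))
      (st (encodeRadius e ++ encodeNetwork name N) [] (encodeTuple encodeRat v).reverse []
        (List.replicate n Letter.zero) [] (List.replicate j Letter.one) [])
      (st (encodeNetwork name N) pre.reverse [] []
        (List.replicate n Letter.zero) (encodeWord s) (List.replicate j Letter.one) [])
      ((w.length + 25) * (encodeTuple encodeRat v).length + 2 * w.length + 84 +
        2 * (encodeRadius e).length) ∧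
      (toArb h ⟨⟨n, m, N, e, v⟩, j⟩).encode name =
        pre ++ (encodeLift name h s N ++ encodeNetwork name (compareNetwork h j)) := by
    rcases eq_or_ne e 0 with rfl | he
    · refine ⟨_, signs v, by simp [signs], (exec_writeHead_zero name h v).congr
        (by rw [List.append_nil]) (by rw [← hw]; omega), ?_⟩
      rw [toArb, if_pos rfl, toArbOfZero, ArbInstance.encode, encodeNetwork,
        encodeNetwork_liftNetwork]
      simp
    · refine ⟨_, [], by simp, (exec_writeHead name h v he).congr
        (by rw [List.append_nil]; rfl) (by nlinarith), ?_⟩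
      rw [toArb, if_neg he, toArbOfPos, ArbInstance.encode, encodeNetwork_liftNetwork]
      simp
  have h4 := exec_loop_writeLayer name h N s hs [] pre.reverse [] (List.replicate j Letter.one) []
  rw [List.append_nil] at h4
  refine (h1.congr' ?_ |>.seq (h2.seq (h3.seq ((exec_push_inp ..).seq
    (h4.seq (exec_writeTail name h j _)))))).congr ?_ ?_
  · simp [ClassInstance.encode, ArbInstance.encode]
  · rw [henc]
    simp
  · rw [← hw, hL]
    generalize (encodeTuple encodeRat v).length = c at *
    generalize (encodeRadius e).length = r at *
    generalize (encodeNetwork name N).length = l at *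
    generalize w.length = W at *
    have hm2 : (11 * m + W + 40) * m ≤ (11 * l + W + 40) * l := Nat.mul_le_mul (by omega) hm
    nlinarith

theorem isManyOneReduction_toArb {d : ∀ n : ℕ, MetricSpace (Fin n → ℝ)} (hd : IsPNormMetric d) :
    IsManyOneReduction (CR F name d) (aCR F name d) (toArb h) := by
  refine ⟨?_, fun I => holds_toArb h hd I⟩
  obtain ⟨P, hP⟩ : ∃ P : Polynomial ℕ, P = 11 * .X ^ 2 +
    .C (4 * (name ⟨ReLU, h⟩).length + 250) * .X + .C (7 * (name ⟨ReLU, h⟩).length + 250) :=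
    ⟨_, rfl⟩
  -- The result lies reversed on `out`. By `Exec.length_le` it has at most `P` letters, so the final
  -- move takes at most `2 * P + 1` further steps. Input and output share the stack `inp`.
  refine computableInPolyTime_of_exec (Γ := Sym)
    (reduce (name ⟨ReLU, h⟩) ⨾ move .out .inp (fun _ => false) id)
    .inp .inp _ _ _ (3 * P + 1) fun I => ?_
  have h1 := exec_reduce name h I
  have hlen := h1.length_le .out
  have hPe : P.eval (I.encode name).length = 11 * (I.encode name).length ^ 2 +
        (4 * (name ⟨ReLU, h⟩).length + 250) * (I.encode name).length +
        (7 * (name ⟨ReLU, h⟩).length + 250) := by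
    simp [hP]
  have h2 := h1.seq ((exec_move_out_inp ..).congr (t' := st ((toArb h I).encode name)
    [] [] [] [] [] [] []) (by simp) le_rfl)
  rw [st_nil_inp, st_nil_inp] at h2
  refine h2.mono ?_
  change _ ≤ (3 * P + 1).eval (I.encode name).length
  simp only [st_out, List.length_nil] at hlen
  simp only [Polynomial.eval_add, Polynomial.eval_mul, Polynomial.eval_ofNat, Polynomial.eval_one,
    hPe]
  omega

end Main

end NeuralNet

theorem mainTheorem10 (F : Set (ℝ → ℝ)) (name : F ↪ List Bool)
    (d : ∀ n : ℕ, MetricSpace (Fin n → ℝ)) :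
    (∃ f : NeuralNet.ArbInstance F → List (NeuralNet.ClassInstance F),
      NeuralNet.IsDisjunctiveReduction (NeuralNet.aCR F name d) (NeuralNet.CR F name d) f) ∧
    (NeuralNet.IsPNormMetric d → NeuralNet.ReLU ∈ F →
      ∃ f : NeuralNet.ClassInstance F → NeuralNet.ArbInstance F,
        NeuralNet.IsManyOneReduction (NeuralNet.CR F name d) (NeuralNet.aCR F name d) f ∧ ∀ I, (f I).outDim = 3) :=
  ⟨NeuralNet.exists_isDisjunctiveReduction F name d, fun hd h =>
    ⟨NeuralNet.toArb h, NeuralNet.isManyOneReduction_toArb name h hd,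
      NeuralNet.outDim_toArb h⟩⟩
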